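/- Let $\mathcal M_k$ be the algebra of complex $k\times k$ matrices, with inner product $\langle A,B\rangle=\operatorname{Tr}A^*B$ and normalized trace $\tau(M)=\frac1k\operatorname{Tr}M$. Let $G$ be the set of linear maps $H:\mathcal M_2\to\mathcal M_2$ that satisfy $H(I_2)=0$, are self-adjoint for $\langle\cdot,\cdot\rangle$, and are positive semidefinite, i.e. $\langle M,H(M)\rangle\ge 0$ for all $M\in\mathcal M_2$. Let $G^{CP}$ be the set of $H\in G$ such that $e^{-tH}=\sum_{j\ge0}\frac{(-t)^j}{j!}H^j$ is completely positive for every $t\ge 0$, and let $$G^{CP}_1=\Big\{H\in G^{CP}:\ \inf_{M\ne 0,\ \operatorname{Tr}M=0}\frac{\langle M,H(M)\rangle}{\langle M,M\rangle}=1\Big\}$$ be the set of unit rate generators. **Theorem (logarithmic Sobolev inequality).** Let $n\ge 0$, let $H_1,\dots,H_n\in G^{CP}_1$, and let $H^{(k)}=\mathcal I_{2^{k-1}}\otimes H_k\otimes\mathcal I_{2^{n-k}}$ be the map on $\mathcal M_{2^n}=\mathcal M_2^{\otimes n}$ that acts as $H_k$ on the $k$-th qubit and as the identity on the others. Then for every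 Hermitian positive semidefinite $A\in\mathcal M_{2^n}$ the numbers $\tau(A^2)$, $\tau(A^2\ln A^2)$ and $\tau\big(A\,H^{(k)}(A)\big)$ are real, and $$-\tau(A^2)\ln\tau(A^2)+\tau\big(A^2\ln A^2\big)\ \le\ 2\sum_{k=1}^n\tau\big(A\,H^{(k)}(A)\big),$$ where $A^2\ln A^2$ is defined by the functional calculus and $0\ln 0=0$. -/

import Mathlib

open scoped Matrix Nat ComplexOrder

noncomputable section

namespace QubitLogSobolev

/-- The space of linear maps (superoperators) on the algebra of complex `ι × ι` matrices. -/
abbrev Superoperator (ι : Type*) := Matrix ι ι ℂ →ₗ[ℂ] Matrix ι ι ℂ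

/-- The Hilbert–Schmidt inner product `⟨A, B⟩ = Tr (A* B)`. -/
def hsInner {ι : Type*} [Fintype ι] (A B : Matrix ι ι ℂ) : ℂ := (Aᴴ * B).trace

/-- The normalized trace `τ(M) = (Tr M) / k` on `k × k` matrices. -/
def normTrace {ι : Type*} [Fintype ι] (M : Matrix ι ι ℂ) : ℂ := M.trace / (Fintype.card ι : ℂ)

/-- `L` coincides with its adjoint for the Hilbert–Schmidt inner product. -/
def IsSelfAdjointMap {ι : Type*} [Fintype ι] (L : Superoperator ι) : Prop :=
  ∀ A B : Matrix ι ι ℂ, hsInner A (L B) = hsInner (L A) B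

/-- `L ≥ 0`: `L` is self-adjoint and `⟨M, L M⟩ ≥ 0` for every `M`
(self-adjointness makes this number real). -/
def IsPosSemidefMap {ι : Type*} [Fintype ι] (L : Superoperator ι) : Prop :=
  IsSelfAdjointMap L ∧ ∀ M : Matrix ι ι ℂ, 0 ≤ (hsInner M (L M)).re

/-- The map `ℐ_m ⊗ L` on `m k × m k` matrices: `L` is applied to each of the `k × k` blocks. -/
def ampliation {ι : Type*} (m : ℕ) (L : Superoperator ι)
    (X : Matrix (Fin m × ι) (Fin m × ι) ℂ) : Matrix (Fin m × ι) (Fin m × ι) ℂ :=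
  Matrix.of fun r s => L (Matrix.of fun a b => X (r.1, a) (s.1, b)) r.2 s.2

/-- Complete positivity: `ℐ_m ⊗ L` preserves positive semidefiniteness for all `m`. -/
def IsCompletelyPositive {ι : Type*} (L : Superoperator ι) : Prop :=
  ∀ (m : ℕ) (X : Matrix (Fin m × ι) (Fin m × ι) ℂ),
    X.PosSemidef → (ampliation m L X).PosSemidef

/-- The exponential series of a superoperator on a matrix algebra converges pointwise. -/
theorem summable_exp {ι : Type*} [Fintype ι] (H : Superoperator ι) (t : ℝ)
    (M : Matrix ι ι ℂ) :
    Summable fun j : ℕ => (((-t) ^ j / (j ! : ℝ) : ℝ) : ℂ) • (H ^ j) M := by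
  have key : ∀ (V : Type _) [NormedAddCommGroup V] [NormedSpace ℂ V] [FiniteDimensional ℂ V]
      (T : V →ₗ[ℂ] V) (v : V),
      Summable fun j : ℕ => (((-t) ^ j / (j ! : ℝ) : ℝ) : ℂ) • (T ^ j) v := by
    intro V _ _ _ T v
    have : CompleteSpace V := FiniteDimensional.complete ℂ V
    let S : V →L[ℂ] V := LinearMap.toContinuousLinearMap T
    have h := NormedSpace.expSeries_summable' (𝕂 := ℂ) (((-t : ℝ) : ℂ) • S)
    have h2 := (ContinuousLinearMap.apply ℂ V v).summable h
    have hS : ∀ (j : ℕ) (w : V), (S ^ j) w = (T ^ j) w := by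
      intro j
      induction j with
      | zero => intro w; simp
      | succ j ih => intro w; rw [pow_succ, pow_succ]; simp [ih, S]
    refine h2.congr fun j => ?_
    simp only [smul_pow, ContinuousLinearMap.apply_apply, smul_apply, hS,
      smul_smul]
    congr 1
    push_cast
    rw [div_eq_inv_mul]
  let _ : NormedAddCommGroup (Matrix ι ι ℂ) := Matrix.normedAddCommGroup
  let _ : NormedSpace ℂ (Matrix ι ι ℂ) := Matrix.normedSpace
  exact key (Matrix ι ι ℂ) H M

/-- The semigroup `e^{-tH}`, `M ↦ ∑ⱼ ((-t)^j / j!) H^j(M)`. -/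
def expSemigroup {ι : Type*} [Fintype ι] (H : Superoperator ι) (t : ℝ) : Superoperator ι where
  toFun M := ∑' j : ℕ, (((-t) ^ j / (j ! : ℝ) : ℝ) : ℂ) • (H ^ j) M
  map_add' M N := by
    rw [← (summable_exp H t M).tsum_add (summable_exp H t N)]
    simp only [map_add, smul_add]
  map_smul' c M := by
    rw [RingHom.id_apply, ← (summable_exp H t M).tsum_const_smul c]
    simp only [map_smul, smul_comm c]

/-- The set `G`: superoperators `H ≥ 0` on `2 × 2` matrices with `H(I) = 0`. -/
def generators : Set (Superoperator (Fin 2)) :=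
  {H | H 1 = 0 ∧ IsPosSemidefMap H}

/-- The set `G^{CP}`: those `H` in `G` for which `e^{-tH}` is completely positive for all `t ≥ 0`. -/
def generatorsCP : Set (Superoperator (Fin 2)) :=
  {H | H ∈ generators ∧ ∀ t : ℝ, 0 ≤ t → IsCompletelyPositive (expSemigroup H t)}

/-- `‖H‖_min`, the infimum of `⟨M, H M⟩ / ⟨M, M⟩` over the nonzero traceless `M`. -/
def minNorm (H : Superoperator (Fin 2)) : ℝ :=
  sInf {r : ℝ | ∃ M : Matrix (Fin 2) (Fin 2) ℂ, M ≠ 0 ∧ M.trace = 0 ∧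
    r = (hsInner M (H M)).re / (hsInner M M).re}

/-- The unit rate generators `G^{CP}_1`. -/
def unitRateGenerators : Set (Superoperator (Fin 2)) :=
  {H | H ∈ generatorsCP ∧ minNorm H = 1}

/-- The matrix algebra `ℳ_{2^n} = ℳ_2 ⊗ ⋯ ⊗ ℳ_2` of `n` qubits; the standard basis of
`(ℂ²)^{⊗n}` is indexed by the `2^n` strings `Fin n → Fin 2`. -/
abbrev QubitMatrix (n : ℕ) := Matrix (Fin n → Fin 2) (Fin n → Fin 2) ℂ

/-- The map `H^{(k)} = ℐ ⊗ ⋯ ⊗ ℐ ⊗ H ⊗ ℐ ⊗ ⋯ ⊗ ℐ`, with `H` acting on the `k`-th qubit: for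
each value of the indices of the other qubits, `H` is applied to the `2 × 2` block of `A` in
which only the indices of qubit `k` vary. -/
def onQubit {n : ℕ} (k : Fin n) (H : Superoperator (Fin 2)) :
    QubitMatrix n →ₗ[ℂ] QubitMatrix n where
  toFun A := Matrix.of fun x y =>
    H (Matrix.of fun a b => A (Function.update x k a) (Function.update y k b)) (x k) (y k)
  map_add' A B := by
    ext x y
    exact congrFun (congrFun (map_add H
      (Matrix.of fun a b => A (Function.update x k a) (Function.update y k b))
      (Matrix.of fun a b => B (Function.update x k a) (Function.update y k b))) (x k)) (y k)
  map_smul' c A := by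
    ext x y
    exact congrFun (congrFun (map_smul H c
      (Matrix.of fun a b => A (Function.update x k a) (Function.update y k b))) (x k)) (y k)

/-- The logarithm of a Hermitian matrix by the functional calculus, with value `0` on the kernel,
so that `B * matLog B` for `B ≥ 0` follows the convention `0 ln 0 = 0`. -/
def matLog {ι : Type*} [Fintype ι] [DecidableEq ι] (B : Matrix ι ι ℂ) : Matrix ι ι ℂ :=
  cfc Real.log B

end QubitLogSobolev

end

open QubitLogSobolev

namespace QubitLogSobolev

/-! A unit rate generator dominates the depolarizing generator `M ↦ M - τ(M) I` as a quadratic form: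
both kill the identity, and on traceless matrices one is at least `1` and the other equals `1`.
Applied to every `2 × 2` block in which one qubit varies, this reduces the theorem to depolarizing
generators (`dirichletForm_le`).

That case is `relEntropy_le_dirichletForm`, by induction on the number of qubits. The first qubit
cuts a positive `M` into blocks `X, Y, Yᴴ, Z`, and `relEntropy_fromBlocks_le` bounds the entropy of
`M` by the entropies of the four blocks plus the Dirichlet form of that qubit. The induction
hypothesis is then needed for `Y`, which is not positive, so the statement is proved for all
matrices: replacing `Y` by its moduli `|Y|` and `|Yᴴ|` keeps the entropy and does not raise the
average Dirichlet form (`dirichletForm_moduli_le`).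

For the block inequality, singular vectors make `Y` a real diagonal `y`. A Schur complement and the
concavity of `log det` give, for every `s > 0`, `log det (s + M) + ∑ y_k² / ((s + X_kk)(s + Z_kk)) ≤
log det (s + X) + log det (s + Z)`. Integration against `s ds` turns `log (s + t)` into `t² log t`,
up to quadratic terms that cancel (`sum_sq_mul_log_le`). This bounds `Tr M² ln M` through `X`, `Z`
and `y`. Jensen's inequality reduces what remains to the three numbers `‖X‖, ‖Z‖, ‖Y‖²`, and
`qubit_entropy_bound` settles it by the two-point logarithmic Sobolev inequality. -/

variable {ι κ : Type*} [Fintype ι] [DecidableEq ι] [Fintype κ] [DecidableEq κ]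

/-! ### Spectral sums, singular values and the concavity of `log det`. -/

/-- The real diagonal matrix with the given entries, as a complex matrix. -/
def realDiagonal (d : ι → ℝ) : Matrix ι ι ℂ := Matrix.diagonal fun i => (d i : ℂ)

omit [Fintype ι] in
theorem realDiagonal_conjTranspose (d : ι → ℝ) : (realDiagonal d)ᴴ = realDiagonal d := by
  simp [realDiagonal, Matrix.diagonal_conjTranspose, Pi.star_def]

theorem realDiagonal_mul (d e : ι → ℝ) :
    realDiagonal d * realDiagonal e = realDiagonal fun i => d i * e i := by
  simp [realDiagonal, Matrix.diagonal_mul_diagonal]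

omit [Fintype ι] in
theorem realDiagonal_one : realDiagonal (fun _ : ι => (1 : ℝ)) = 1 := by
  simp [realDiagonal]

/-- The sum of `f` over the real parts of the eigenvalues of `M`, with multiplicity. -/
noncomputable def spectralSum (f : ℝ → ℝ) (M : Matrix ι ι ℂ) : ℝ :=
  (M.charpoly.roots.map fun z => f z.re).sum

theorem spectralSum_eq_of_charpoly_eq (f : ℝ → ℝ) {M : Matrix ι ι ℂ} {N : Matrix κ κ ℂ}
    (h : M.charpoly = N.charpoly) : spectralSum f M = spectralSum f N := by
  rw [spectralSum, spectralSum, h]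

/-- Counting eigenvalues through the characteristic polynomial gives cyclicity without hermiticity
of `A * B`; unitary invariance and the equality of the entropies of `Y` and `Yᴴ` follow from it. -/
theorem spectralSum_mul_comm (f : ℝ → ℝ) (A B : Matrix ι ι ℂ) :
    spectralSum f (A * B) = spectralSum f (B * A) :=
  spectralSum_eq_of_charpoly_eq f (Matrix.charpoly_mul_comm A B)

theorem spectralSum_submatrix_equiv (f : ℝ → ℝ) (e : κ ≃ ι) (M : Matrix ι ι ℂ) :
    spectralSum f (M.submatrix e e) = spectralSum f M :=
  spectralSum_eq_of_charpoly_eq f (Matrix.charpoly_reindex e.symm M)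

theorem spectralSum_realDiagonal (f : ℝ → ℝ) (d : ι → ℝ) :
    spectralSum f (realDiagonal d) = ∑ i, f (d i) := by
  rw [spectralSum, realDiagonal, Matrix.charpoly_diagonal, Polynomial.roots_prod]
  · simp
  · exact Finset.prod_ne_zero_iff.2 fun i _ => Polynomial.X_sub_C_ne_zero _

theorem spectralSum_conj (f : ℝ → ℝ) {U : Matrix ι ι ℂ} (hU : Uᴴ * U = 1) (M : Matrix ι ι ℂ) :
    spectralSum f (U * M * Uᴴ) = spectralSum f M := by
  rw [spectralSum_mul_comm, ← mul_assoc, hU, one_mul]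

theorem exists_unitary_diagonalization {M : Matrix ι ι ℂ} (hM : M.IsHermitian) :
    ∃ U : Matrix ι ι ℂ, Uᴴ * U = 1 ∧ U * Uᴴ = 1 ∧ M = U * realDiagonal hM.eigenvalues * Uᴴ := by
  refine ⟨hM.eigenvectorUnitary, ?_, ?_, ?_⟩
  · exact Unitary.coe_star_mul_self _
  · exact Unitary.coe_mul_star_self _
  · conv_lhs => rw [hM.spectral_theorem]
    rfl

theorem spectralSum_isHermitian (f : ℝ → ℝ) {M : Matrix ι ι ℂ} (hM : M.IsHermitian) :
    spectralSum f M = ∑ i, f (hM.eigenvalues i) := by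
  obtain ⟨U, hU, -, h⟩ := exists_unitary_diagonalization hM
  conv_lhs => rw [h]
  rw [spectralSum_conj f hU, spectralSum_realDiagonal]

theorem spectralSum_mul_self (f : ℝ → ℝ) {M : Matrix ι ι ℂ} (hM : M.IsHermitian) :
    spectralSum f (M * M) = spectralSum (fun t => f (t * t)) M := by
  obtain ⟨U, hU, -, h⟩ := exists_unitary_diagonalization hM
  have : M * M = U * realDiagonal (fun i => hM.eigenvalues i * hM.eigenvalues i) * Uᴴ := by
    calc M * M = (U * realDiagonal hM.eigenvalues * Uᴴ) * (U * realDiagonal hM.eigenvalues * Uᴴ) := by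
          rw [← h]
      _ = U * realDiagonal hM.eigenvalues * (Uᴴ * U) * realDiagonal hM.eigenvalues * Uᴴ := by
          simp only [mul_assoc]
      _ = _ := by rw [hU, mul_one, mul_assoc U, realDiagonal_mul]
  rw [this, spectralSum_conj f hU, spectralSum_realDiagonal, spectralSum_isHermitian _ hM]

theorem exists_singularValueDecomposition (Y : Matrix ι ι ℂ) :
    ∃ (U V : Matrix ι ι ℂ) (y : ι → ℝ), Uᴴ * U = 1 ∧ U * Uᴴ = 1 ∧ Vᴴ * V = 1 ∧ V * Vᴴ = 1 ∧
      (∀ i, 0 ≤ y i) ∧ Y = U * realDiagonal y * Vᴴ := by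
  have hP : (Yᴴ * Y).PosSemidef := Matrix.posSemidef_conjTranspose_mul_self Y
  obtain ⟨V, hV, hV', h⟩ := exists_unitary_diagonalization hP.1
  set l := hP.1.eigenvalues with hl
  have hl0 : ∀ i, 0 ≤ l i := hP.eigenvalues_nonneg
  have hYV : (Y * V)ᴴ * (Y * V) = realDiagonal l := by
    calc (Y * V)ᴴ * (Y * V) = Vᴴ * (Yᴴ * Y) * V := by
          rw [Matrix.conjTranspose_mul]; simp only [mul_assoc]
      _ = (Vᴴ * V) * realDiagonal l * (Vᴴ * V) := by rw [h]; simp only [mul_assoc]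
      _ = _ := by rw [hV, one_mul, mul_one]
  -- The columns of `Y V` are orthogonal with squared norms `l j`. The nonzero ones, normalized,
  -- extend to an orthonormal basis, whose vectors are the columns of `U`.
  let w : ι → EuclideanSpace ℂ ι := fun j => WithLp.toLp 2 fun i => (Y * V) i j
  have hw : ∀ i j, inner ℂ (w i) (w j) = if i = j then (l i : ℂ) else 0 := by
    intro i j
    have := congrFun (congrFun hYV i) j
    rw [Matrix.mul_apply, realDiagonal, Matrix.diagonal_apply] at this
    rw [← this, PiLp.inner_apply]
    exact Finset.sum_congr rfl fun k _ => by simp [w, mul_comm]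
  let v : ι → EuclideanSpace ℂ ι := fun j => ((Real.sqrt (l j) : ℂ))⁻¹ • w j
  have hv : Orthonormal ℂ (({j | l j ≠ 0} : Set ι).domRestrict v) := by
    rw [orthonormal_iff_ite]
    rintro ⟨i, hi⟩ ⟨j, hj⟩
    change inner ℂ (v i) (v j) = _
    simp only [v, inner_smul_left, inner_smul_right, hw, Subtype.mk.injEq]
    split_ifs with hij
    · subst hij
      have h1 : ((Real.sqrt (l i) : ℂ)) * (Real.sqrt (l i) : ℂ) = l i := by
        rw [← Complex.ofReal_mul, Real.mul_self_sqrt (hl0 i)]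
      have h2 : (Real.sqrt (l i) : ℂ) ≠ 0 := by
        rw [Complex.ofReal_ne_zero, Real.sqrt_ne_zero (hl0 i)]; exact hi
      rw [← h1]
      simp only [map_inv₀, Complex.conj_ofReal]
      field_simp
    · simp
  obtain ⟨b, hb⟩ := hv.exists_orthonormalBasis_extension_of_card_eq
    (by rw [finrank_euclideanSpace])
  let U : Matrix ι ι ℂ := Matrix.of fun i j => b j i
  have hU : Uᴴ * U = 1 := by
    ext i j
    have := (orthonormal_iff_ite.1 b.orthonormal) i j
    rw [Matrix.mul_apply, Matrix.one_apply, ← this, PiLp.inner_apply]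
    exact Finset.sum_congr rfl fun k _ => by simp [U, mul_comm]
  refine ⟨U, V, fun i => Real.sqrt (l i), hU, mul_eq_one_comm.1 hU, hV, hV',
    fun i => Real.sqrt_nonneg _, ?_⟩
  have key : Y * V = U * realDiagonal fun i => Real.sqrt (l i) := by
    ext i j
    rw [realDiagonal, Matrix.mul_diagonal]
    by_cases hj : l j = 0
    · have h0 : w j = 0 := by
        have := hw j j
        rw [if_pos rfl, hj, Complex.ofReal_zero, inner_self_eq_zero] at this
        exact this
      have : (Y * V) i j = w j i := rfl
      rw [this, h0, hj]; simp
    · have h2 : (Real.sqrt (l j) : ℂ) ≠ 0 := by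
        rw [Complex.ofReal_ne_zero, Real.sqrt_ne_zero (hl0 j)]; exact hj
      have : U i j = v j i := by
        simp only [U, Matrix.of_apply, hb j hj]
      rw [this]
      simp only [v, PiLp.smul_apply, w, smul_eq_mul]
      field_simp
  rw [← key, mul_assoc, hV', mul_one]

theorem spectralSum_log_add {M : Matrix ι ι ℂ} (hM : M.PosSemidef) {s : ℝ} (hs : 0 < s) :
    spectralSum (fun t => Real.log (s + t)) M = Real.log ((s : ℂ) • (1 : Matrix ι ι ℂ) + M).det.re := by
  obtain ⟨U, hU, hU', h⟩ := exists_unitary_diagonalization hM.1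
  have : (s : ℂ) • (1 : Matrix ι ι ℂ) + M
      = U * realDiagonal (fun i => s + hM.1.eigenvalues i) * Uᴴ := by
    have hd : realDiagonal (fun i => s + hM.1.eigenvalues i)
        = (s : ℂ) • (1 : Matrix ι ι ℂ) + realDiagonal hM.1.eigenvalues := by
      ext i j
      by_cases hij : i = j <;> simp [realDiagonal, hij]
    rw [hd, mul_add, add_mul, ← h, Matrix.mul_smul, Matrix.smul_mul, mul_one, hU']
  rw [spectralSum_isHermitian _ hM.1, this, Matrix.det_mul_comm, ← mul_assoc, hU, one_mul,
    realDiagonal, Matrix.det_diagonal, ← Complex.ofReal_prod, Complex.ofReal_re, Real.log_prod]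
  intro i _
  have := hM.eigenvalues_nonneg i
  positivity

/-- Concavity of `log det`, as the tangent bound at `P`: with `P⁻¹ = C Cᴴ`, apply `log x ≤ x - 1` to
the eigenvalues of `Cᴴ Q C`. -/
theorem log_det_le {P Q : Matrix ι ι ℂ} (hP : P.PosDef) (hQ : Q.PosDef) :
    Real.log Q.det.re ≤ Real.log P.det.re + (P⁻¹ * Q).trace.re - Fintype.card ι := by
  obtain ⟨C, hC, hCP⟩ : ∃ C : Matrix ι ι ℂ, IsUnit C ∧ P⁻¹ = C * Cᴴ := by
    obtain ⟨U, hU, hU', h⟩ := exists_unitary_diagonalization hP.inv.1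
    have hpos := hP.inv.eigenvalues_pos
    have : P⁻¹ = (U * realDiagonal fun i => Real.sqrt (hP.inv.1.eigenvalues i)) *
        (U * realDiagonal fun i => Real.sqrt (hP.inv.1.eigenvalues i))ᴴ := by
      conv_lhs => rw [h]
      rw [Matrix.conjTranspose_mul, realDiagonal_conjTranspose, mul_assoc, mul_assoc U,
        ← mul_assoc (realDiagonal _) (realDiagonal _), realDiagonal_mul]
      simp only [Real.mul_self_sqrt (hpos _).le]
    refine ⟨_, ?_, this⟩
    have h1 := hP.inv.isUnit
    rw [this] at h1
    rw [Matrix.isUnit_iff_isUnit_det] at h1 ⊢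
    rw [Matrix.det_mul] at h1
    exact isUnit_of_mul_isUnit_left h1
  have hB : (Cᴴ * Q * C).PosDef := by
    refine hQ.conjTranspose_mul_mul_same ?_
    exact Matrix.mulVec_injective_of_isUnit hC
  have htr : (P⁻¹ * Q).trace = (Cᴴ * Q * C).trace := by
    rw [hCP, mul_assoc, Matrix.trace_mul_comm]
  have hdet : (Cᴴ * Q * C).det = P.det⁻¹ * Q.det := by
    rw [Matrix.det_mul_comm, ← mul_assoc, ← hCP, Matrix.det_mul, Matrix.det_nonsing_inv,
      Ring.inverse_eq_inv']
  have hPd := hP.det_pos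
  have hQd := hQ.det_pos
  have e1 : P.det = (P.det.re : ℂ) := (Complex.eq_re_of_ofReal_le hPd.le)
  have e2 : Q.det = (Q.det.re : ℂ) := (Complex.eq_re_of_ofReal_le hQd.le)
  have p1 : 0 < P.det.re := by rw [e1] at hPd; exact_mod_cast hPd
  have p2 : 0 < Q.det.re := by rw [e2] at hQd; exact_mod_cast hQd
  have hpos := hB.eigenvalues_pos
  have h1 : P.det.re⁻¹ * Q.det.re = ∏ i, hB.1.eigenvalues i := by
    have := hB.1.det_eq_prod_eigenvalues
    rw [hdet, e1, e2] at this
    apply Complex.ofReal_injective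
    push_cast
    exact this
  have h2 : (Cᴴ * Q * C).trace.re = ∑ i, hB.1.eigenvalues i := by
    rw [hB.1.trace_eq_sum_eigenvalues]; simp
  rw [htr, h2]
  have h3 := congrArg Real.log h1
  rw [Real.log_mul (inv_ne_zero p1.ne') p2.ne', Real.log_inv,
    Real.log_prod fun i _ => (hpos i).ne'] at h3
  have h4 : ∑ i, Real.log (hB.1.eigenvalues i) ≤ ∑ i, (hB.1.eigenvalues i - 1) :=
    Finset.sum_le_sum fun i _ => Real.log_le_sub_one_of_pos (hpos i)
  rw [Finset.sum_sub_distrib] at h4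
  simp only [Finset.sum_const, Finset.card_univ, nsmul_eq_mul, mul_one] at h4
  linarith

/-! ### Scalar inequalities, and integration over the parameter `s`. -/

open Filter Topology

/-- The logarithmic Sobolev inequality of the two-point space. -/
theorem two_point_logSobolev {a b : ℝ} (ha : 0 ≤ a) (hb : 0 ≤ b) :
    a ^ 2 * Real.log (a ^ 2) + b ^ 2 * Real.log (b ^ 2)
      ≤ (a ^ 2 + b ^ 2) * Real.log ((a ^ 2 + b ^ 2) / 2) + (a - b) ^ 2 := by
  wlog hab : b ≤ a generalizing a b
  · have := this hb ha (le_of_not_ge hab)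
    rw [add_comm (b ^ 2) (a ^ 2)] at this
    nlinarith [this]
  rcases ha.eq_or_lt with rfl | ha'
  · have : b = 0 := le_antisymm hab hb
    subst this; simp
  -- By homogeneity only `t = b / a` in `[0, 1]` matters. The function `g` decreases to `g 1 = 0`.
  let g : ℝ → ℝ := fun t =>
    (1 + t ^ 2) * Real.log ((1 + t ^ 2) / 2) + (1 - t) ^ 2 - t ^ 2 * Real.log (t ^ 2)
  have hg : ∀ t ∈ Set.Icc (0 : ℝ) 1, 0 ≤ g t := by
    have hanti : AntitoneOn g (Set.Icc 0 1) := by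
      apply antitoneOn_of_deriv_nonpos (convex_Icc 0 1)
      · refine Continuous.continuousOn ?_
        have h1 : Continuous fun t : ℝ => t ^ 2 * Real.log (t ^ 2) :=
          Real.continuous_mul_log.comp (continuous_pow 2)
        have h2 : Continuous fun t : ℝ => Real.log ((1 + t ^ 2) / 2) :=
          Continuous.log (by fun_prop) fun t => by positivity
        fun_prop
      · intro t ht
        rw [interior_Icc] at ht
        have h0 : t ^ 2 ≠ 0 := by have := ht.1; positivity
        have h1 : (1 + t ^ 2) / 2 ≠ 0 := by positivity
        fun_prop (disch := assumption)
      · intro t ht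
        rw [interior_Icc] at ht
        have ht0 : 0 < t := ht.1
        have hd : HasDerivAt g (2 * t * (Real.log ((1 + t ^ 2) / 2) - Real.log (t ^ 2))
            - 2 * (1 - t)) t := by
          have e1 : HasDerivAt (fun t : ℝ => 1 + t ^ 2) (2 * t) t := by
            simpa using (hasDerivAt_pow 2 t).const_add 1
          have e2 := (e1.div_const 2).log (by positivity)
          have e3 : HasDerivAt (fun t : ℝ => (1 - t) ^ 2) (2 * (1 - t) * (-1)) t := by
            simpa using ((hasDerivAt_id t).const_sub 1).fun_pow 2
          have e4 : HasDerivAt (fun t : ℝ => t ^ 2) (2 * t) t := by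
            simpa using hasDerivAt_pow 2 t
          have e5 := e4.log (by positivity)
          refine (((e1.mul e2).add e3).sub (e4.mul e5)).congr_deriv ?_
          have : 1 + t ^ 2 ≠ 0 := by positivity
          field_simp
          ring
        rw [hd.deriv]
        -- With `v = 1 / t - 1`, the quotient `(1 + t²) / (2 t²)` is exactly `1 + v + v² / 2`, which
        -- is at most `exp v`.
        have hexp := Real.quadratic_le_exp_of_nonneg (x := 1 / t - 1) (by
          rw [sub_nonneg, le_div_iff₀ ht0]; linarith [ht.2])
        have hlog : Real.log ((1 + t ^ 2) / 2) - Real.log (t ^ 2) ≤ 1 / t - 1 := by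
          rw [← Real.log_div (by positivity) (by positivity),
            Real.log_le_iff_le_exp (by positivity)]
          refine le_trans (le_of_eq ?_) hexp
          field_simp
          ring
        have := mul_le_mul_of_nonneg_left hlog (by positivity : 0 ≤ 2 * t)
        have h2 : 2 * t * (1 / t - 1) = 2 * (1 - t) := by field_simp
        linarith
    intro t ht
    have := hanti ht (Set.right_mem_Icc.2 zero_le_one) ht.2
    have h1 : g 1 = 0 := by simp only [g]; norm_num
    linarith
  have hm : b / a ∈ Set.Icc (0 : ℝ) 1 := ⟨by positivity, by rw [div_le_one ha']; exact hab⟩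
  have key := mul_nonneg (sq_nonneg a) (hg _ hm)
  have e1 : (a ^ 2 + b ^ 2) / 2 = a ^ 2 * ((1 + (b / a) ^ 2) / 2) := by field_simp
  rw [e1, Real.log_mul (by positivity) (by positivity)]
  have e2 : b ^ 2 * Real.log (b ^ 2) = b ^ 2 * (Real.log (a ^ 2) + Real.log ((b / a) ^ 2)) := by
    rcases hb.eq_or_lt with rfl | hb'
    · simp
    · rw [← Real.log_mul (by positivity) (by positivity)]
      congr 2; field_simp
  rw [e2]
  have e3 : a ^ 2 * g (b / a) = (a ^ 2 + b ^ 2) * Real.log ((1 + (b / a) ^ 2) / 2) + (a - b) ^ 2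
      - b ^ 2 * Real.log ((b / a) ^ 2) := by
    simp only [g]; field_simp
  rw [e3] at key
  linarith

/-- Here `x`, `z` and `r` stand for `‖X‖`, `‖Z‖` and `‖Y‖²`. The case `r = 0` is the two-point
inequality; the off-diagonal part costs `6 r` against a Dirichlet term `4 r`, and the missing `2 r`
comes from the growth of the logarithm between `p` and `p + 2 r`, where `p = x² + z²`. -/
theorem qubit_entropy_bound {x z r : ℝ} (hx : 0 ≤ x) (hz : 0 ≤ z) (hr : 0 ≤ r) (hrxz : r ≤ x * z) :
    x ^ 2 * Real.log (x ^ 2) + z ^ 2 * Real.log (z ^ 2) + 2 * r * Real.log (((x + z) / 2) ^ 2)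
        + 6 * r
      ≤ (x ^ 2 + z ^ 2 + 2 * r) * Real.log ((x ^ 2 + z ^ 2 + 2 * r) / 2) + (x - z) ^ 2 + 4 * r := by
  have htp := two_point_logSobolev hx hz
  rcases (add_nonneg hx hz).eq_or_lt with h0 | hpos
  · obtain rfl : x = 0 := by linarith
    obtain rfl : z = 0 := by linarith
    obtain rfl : r = 0 := by nlinarith
    simp
  set p := x ^ 2 + z ^ 2 with hp
  have hq : ((x + z) / 2) ^ 2 ≤ p / 2 := by nlinarith [sq_nonneg (x - z)]
  have hq0 : 0 < ((x + z) / 2) ^ 2 := by positivity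
  have hp0 : 0 < p := by linarith
  have h1 : 2 * r * Real.log (((x + z) / 2) ^ 2) ≤ 2 * r * Real.log (p / 2) :=
    mul_le_mul_of_nonneg_left (Real.log_le_log hq0 hq) (by positivity)
  have h2 : 1 - p / (p + 2 * r) ≤ Real.log ((p + 2 * r) / 2) - Real.log (p / 2) := by
    rw [← Real.log_div (by positivity) (by positivity)]
    have := Real.one_sub_inv_le_log_of_pos (x := (p + 2 * r) / 2 / (p / 2)) (by positivity)
    refine le_trans (le_of_eq ?_) this
    field_simp
  have h3 := mul_le_mul_of_nonneg_left h2 (by positivity : 0 ≤ p + 2 * r)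
  have h4 : (p + 2 * r) * (1 - p / (p + 2 * r)) = 2 * r := by field_simp; ring
  rw [h4] at h3
  linarith

/-- The log-sum form of Jensen's inequality: each term uses `log u ≤ u - 1` at `u = b k * P / (p k *
Q)`. -/
theorem sum_mul_log_sub_log_le {K : Type*} [Fintype K] {p b : K → ℝ} {Q : ℝ}
    (hp : ∀ k, 0 ≤ p k) (hb : ∀ k, 0 ≤ b k) (hpb : ∀ k, b k = 0 → p k = 0) (hQ : ∑ k, b k ≤ Q) :
    ∑ k, p k * (Real.log (b k) - Real.log (p k))
      ≤ (∑ k, p k) * (Real.log Q - Real.log (∑ k, p k)) := by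
  set P := ∑ k, p k with hP
  rcases (Finset.sum_nonneg fun k _ => hp k : 0 ≤ P).eq_or_lt with h0 | hpos
  · have : ∀ k, p k = 0 := fun k =>
      (Finset.sum_eq_zero_iff_of_nonneg fun k _ => hp k).1 h0.symm k (Finset.mem_univ k)
    simp [this, hP]
  have hB : 0 < ∑ k, b k := by
    refine (Finset.sum_nonneg fun k _ => hb k).lt_of_ne' fun h => hpos.ne' ?_
    refine Finset.sum_eq_zero fun k hk => hpb k ?_
    exact (Finset.sum_eq_zero_iff_of_nonneg fun k _ => hb k).1 h k hk
  have hQ0 : 0 < Q := hB.trans_le hQ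
  have hterm : ∀ k, p k * (Real.log (b k) - Real.log (p k))
      ≤ p k * (Real.log Q - Real.log P) + (b k * (P / Q) - p k) := by
    intro k
    rcases (hp k).eq_or_lt with h | h
    · rw [← h]; have := hb k; simp only [zero_mul, zero_add, sub_zero]; positivity
    have hbk : 0 < b k := (hb k).lt_of_ne' fun h' => h.ne' (hpb k h')
    have h1 := Real.log_le_sub_one_of_pos (x := b k * P / (p k * Q)) (by positivity)
    rw [Real.log_div (by positivity) (by positivity), Real.log_mul hbk.ne' hpos.ne',
      Real.log_mul h.ne' hQ0.ne'] at h1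
    have h2 := mul_le_mul_of_nonneg_left h1 h.le
    have h3 : p k * (b k * P / (p k * Q) - 1) = b k * (P / Q) - p k := by field_simp
    rw [h3] at h2
    linarith
  refine (Finset.sum_le_sum fun k _ => hterm k).trans ?_
  rw [Finset.sum_add_distrib, ← Finset.sum_mul, Finset.sum_sub_distrib, ← Finset.sum_mul, ← hP]
  have : (∑ k, b k) * (P / Q) ≤ P := by
    calc (∑ k, b k) * (P / Q) ≤ Q * (P / Q) := by gcongr
      _ = P := by field_simp
  linarith

theorem tendsto_sq_sub_sq_mul_log_one_add_div (t : ℝ) :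
    Tendsto (fun R : ℝ => (R ^ 2 - t ^ 2) / 2 * Real.log (1 + t / R) - t * R / 2) atTop
      (𝓝 (-t ^ 2 / 4)) := by
  have hu : Tendsto (fun R : ℝ => t / R) atTop (𝓝 0) := tendsto_const_nhds.div_atTop tendsto_id
  have hlog : Tendsto (fun R : ℝ => Real.log (1 + t / R)) atTop (𝓝 0) := by
    have : Tendsto (fun R : ℝ => 1 + t / R) atTop (𝓝 1) := by simpa using hu.const_add 1
    simpa using this.log one_ne_zero
  -- The second order expansion of `log (1 + u)` at `u = t / R` has a cubic remainder, so
  -- multiplication by `R²` still leaves a null sequence.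
  have hrem : Tendsto (fun R : ℝ => R ^ 2 * (Real.log (1 + t / R) - t / R + (t / R) ^ 2 / 2)) atTop
      (𝓝 0) := by
    have hbd : Tendsto (fun R : ℝ => t ^ 2 * (|t / R| / (1 - |t / R|))) atTop (𝓝 0) := by
      have h1 : Tendsto (fun R : ℝ => |t / R|) atTop (𝓝 0) := by simpa using hu.abs
      have h2 := (h1.div (h1.const_sub 1) (by norm_num)).const_mul (t ^ 2)
      simpa using h2
    refine squeeze_zero_norm' ?_ hbd
    filter_upwards [eventually_gt_atTop 0, eventually_gt_atTop (|t|)] with R hR hRt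
    have hlt : |-(t / R)| < 1 := by
      rw [abs_neg, abs_div, abs_of_pos hR, div_lt_one hR]; exact hRt
    have h := Real.abs_log_sub_add_sum_range_le hlt 2
    simp only [Finset.sum_range_succ, Finset.sum_range_zero, abs_neg, sub_neg_eq_add] at h
    rw [Real.norm_eq_abs, abs_mul, abs_of_pos (by positivity : 0 < R ^ 2)]
    have e1 : Real.log (1 + t / R) - t / R + (t / R) ^ 2 / 2
        = 0 + (-(t / R)) ^ (0 + 1) / ((0 : ℕ) + 1 : ℝ) + (-(t / R)) ^ (1 + 1) / ((1 : ℕ) + 1 : ℝ)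
          + Real.log (1 + t / R) := by push_cast; ring
    rw [e1]
    calc _ ≤ R ^ 2 * (|t / R| ^ (2 + 1) / (1 - |t / R|)) := by gcongr
      _ = _ := by
        have : R ^ 2 * |t / R| ^ (2 + 1) = t ^ 2 * |t / R| := by
          rw [pow_succ |t / R|, sq_abs]; field_simp
        rw [← mul_div_assoc, this, mul_div_assoc]
  have h := (hrem.const_mul (1 / 2)).sub (hlog.const_mul (t ^ 2 / 2)) |>.sub_const (t ^ 2 / 4)
  refine (h.congr' ?_).trans (by simp [neg_div])
  filter_upwards [eventually_gt_atTop 0] with R hR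
  field_simp
  ring

/-- An inequality between sums of `log (s + t)` valid for all `s > 0` passes to the corresponding
sums of `t² log t`, provided that the moments of order at most two match. -/
theorem sum_sq_mul_log_le {T K : Type*} [Fintype T] [Fintype K] {w t : T → ℝ} {r c : K → ℝ}
    (ht : ∀ i, 0 ≤ t i) (hc : ∀ k, 0 ≤ c k) (hrc : ∀ k, c k = 0 → r k = 0)
    (h : ∀ s, 0 < s → ∑ i, w i * Real.log (s + t i) + ∑ k, r k / (s + c k) ^ 2 ≤ 0)
    (h0 : ∑ i, w i = 0) (h1 : ∑ i, w i * t i = 0) (h2 : ∑ i, w i * t i ^ 2 = 2 * ∑ k, r k) :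
    ∑ i, w i * (t i ^ 2 * Real.log (t i)) ≤ ∑ k, r k * (2 * Real.log (c k) + 3) := by
  -- `f i` and `g k` are the antiderivatives of `s log (s + t i)` and `s r k / (s + c k)²` that
  -- vanish at `0`. Hence `F` is nonincreasing from `F 0 = 0`, and its limit at infinity is the
  -- claim up to a factor.
  let f : T → ℝ → ℝ := fun i s => (s ^ 2 - t i ^ 2) / 2 * Real.log (s + t i)
    + t i ^ 2 / 2 * Real.log (t i) - s ^ 2 / 4 + s * t i / 2
  let g : K → ℝ → ℝ := fun k s =>
    r k * (Real.log (s + c k) - Real.log (c k) + c k / (s + c k) - 1)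
  let F : ℝ → ℝ := fun s => ∑ i, w i * f i s + ∑ k, g k s
  have hF0 : F 0 = 0 := by
    have e1 : ∀ i, f i 0 = 0 := fun i => by simp only [f, zero_add]; ring
    have e2 : ∀ k, g k 0 = 0 := fun k => by
      simp only [g, zero_add]
      by_cases hk : c k = 0
      · rw [hrc k hk, zero_mul]
      · rw [div_self hk]; ring
    simp [F, e1, e2]
  have hcont : ContinuousOn F (Set.Ici 0) := by
    refine ContinuousOn.add (continuousOn_finsetSum _ fun i _ => ?_)
      (continuousOn_finsetSum _ fun k _ => ?_)
    · have : Continuous fun s : ℝ => (s + t i) * Real.log (s + t i) :=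
        Real.continuous_mul_log.comp (by fun_prop)
      have : Continuous fun s : ℝ => (s ^ 2 - t i ^ 2) / 2 * Real.log (s + t i) := by
        -- The factor `s + t i` tames the logarithm, which gives continuity down to `s = 0` even
        -- when `t i = 0`.
        have e : (fun s : ℝ => (s ^ 2 - t i ^ 2) / 2 * Real.log (s + t i))
            = fun s => (s - t i) / 2 * ((s + t i) * Real.log (s + t i)) := by ext s; ring
        rw [e]; fun_prop
      refine Continuous.continuousOn ?_
      simp only [f]
      fun_prop
    · by_cases hk : c k = 0
      · simp only [g, hrc k hk, zero_mul]; exact continuousOn_const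
      · have hk' : 0 < c k := (hc k).lt_of_ne' hk
        have hne : ∀ s ∈ Set.Ici (0 : ℝ), s + c k ≠ 0 := fun s hs => by
          have : 0 ≤ s := hs
          positivity
        have e1 : ContinuousOn (fun s : ℝ => Real.log (s + c k)) (Set.Ici 0) :=
          ContinuousOn.log (by fun_prop) hne
        have e2 : ContinuousOn (fun s : ℝ => c k / (s + c k)) (Set.Ici 0) :=
          continuousOn_const.div (by fun_prop) hne
        simp only [g]
        fun_prop
  have hderiv : ∀ s, 0 < s → HasDerivAt F
      (s * (∑ i, w i * Real.log (s + t i) + ∑ k, r k / (s + c k) ^ 2)) s := by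
    intro s hs
    have e1 : ∀ i, HasDerivAt (f i) (s * Real.log (s + t i)) s := by
      intro i
      have hne : s + t i ≠ 0 := by have := ht i; positivity
      have a1 : HasDerivAt (fun s : ℝ => s ^ 2) (2 * s) s := by simpa using hasDerivAt_pow 2 s
      have a2 := ((hasDerivAt_id s).add_const (t i)).log hne
      have a3 := ((((a1.sub_const (t i ^ 2)).div_const 2).mul a2).add_const
        (t i ^ 2 / 2 * Real.log (t i))).sub (a1.div_const 4) |>.add
        (((hasDerivAt_id s).mul_const (t i)).div_const 2)
      refine a3.congr_deriv ?_
      simp only [id]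
      field_simp
      ring
    have e2 : ∀ k, HasDerivAt (g k) (s * (r k / (s + c k) ^ 2)) s := by
      intro k
      have hne : s + c k ≠ 0 := by have := hc k; positivity
      have a0 := (hasDerivAt_id s).add_const (c k)
      have a3 := (((a0.log hne).sub_const (Real.log (c k))).add
        ((hasDerivAt_const s (c k)).div a0 hne)).sub_const 1 |>.const_mul (r k)
      refine a3.congr_deriv ?_
      simp only [id]
      field_simp
      ring
    have := (HasDerivAt.fun_sum fun i (_ : i ∈ Finset.univ) => (e1 i).const_mul (w i)).add
      (HasDerivAt.fun_sum fun k (_ : k ∈ Finset.univ) => e2 k)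
    refine this.congr_deriv ?_
    rw [mul_add, Finset.mul_sum, Finset.mul_sum]
    congr 1
    exact Finset.sum_congr rfl fun i _ => by ring
  have hanti : AntitoneOn F (Set.Ici 0) := by
    apply antitoneOn_of_deriv_nonpos (convex_Ici 0) hcont
    · intro s hs
      rw [interior_Ici] at hs
      exact (hderiv s hs).differentiableAt.differentiableWithinAt
    · intro s hs
      rw [interior_Ici] at hs
      rw [(hderiv s hs).deriv]
      exact mul_nonpos_of_nonneg_of_nonpos (le_of_lt hs) (h s hs)
  have hFle : ∀ R, 0 < R → F R ≤ 0 := fun R hR => by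
    rw [← hF0]; exact hanti Set.self_mem_Ici hR.le hR.le
  have hlim : Tendsto F atTop (𝓝 (∑ i, w i * (t i ^ 2 / 2 * Real.log (t i)
      + (-t i ^ 2 / 4)) + ∑ k, r k * (0 - Real.log (c k) + 0 - 1))) := by
    have a1 : ∀ i, Tendsto (fun R : ℝ => w i * (t i ^ 2 / 2 * Real.log (t i)
        + ((R ^ 2 - t i ^ 2) / 2 * Real.log (1 + t i / R) - t i * R / 2))) atTop
        (𝓝 (w i * (t i ^ 2 / 2 * Real.log (t i) + (-t i ^ 2 / 4)))) := fun i =>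
      ((tendsto_sq_sub_sq_mul_log_one_add_div (t i)).const_add _).const_mul _
    have a2 : ∀ k, Tendsto (fun R : ℝ => r k * (Real.log (1 + c k / R) - Real.log (c k)
        + c k / (R + c k) - 1)) atTop (𝓝 (r k * (0 - Real.log (c k) + 0 - 1))) := by
      intro k
      have b1 : Tendsto (fun R : ℝ => Real.log (1 + c k / R)) atTop (𝓝 0) := by
        have hu : Tendsto (fun R : ℝ => c k / R) atTop (𝓝 0) :=
          tendsto_const_nhds.div_atTop tendsto_id
        have : Tendsto (fun R : ℝ => 1 + c k / R) atTop (𝓝 1) := by simpa using hu.const_add 1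
        simpa using this.log one_ne_zero
      have b2 : Tendsto (fun R : ℝ => c k / (R + c k)) atTop (𝓝 0) :=
        tendsto_const_nhds.div_atTop (tendsto_atTop_add_const_right _ _ tendsto_id)
      exact (((b1.sub_const _).add b2).sub_const 1).const_mul _
    refine ((tendsto_finsetSum _ fun i _ => a1 i).add
      (tendsto_finsetSum _ fun k _ => a2 k)).congr' ?_
    filter_upwards [eventually_gt_atTop 0] with R hR
    have hl : ∀ u, 0 ≤ u → Real.log (1 + u / R) = Real.log (R + u) - Real.log R := fun u hu => by
      rw [← Real.log_div (by positivity) hR.ne']; congr 1; field_simp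
    have b1 : ∀ i, w i * (t i ^ 2 / 2 * Real.log (t i)
        + ((R ^ 2 - t i ^ 2) / 2 * Real.log (1 + t i / R) - t i * R / 2))
        = w i * f i R + (R ^ 2 / 4 - R ^ 2 / 2 * Real.log R) * w i - R * (w i * t i)
          + Real.log R / 2 * (w i * t i ^ 2) := fun i => by
      rw [hl _ (ht i)]; simp only [f]; ring
    have b2 : ∀ k, r k * (Real.log (1 + c k / R) - Real.log (c k) + c k / (R + c k) - 1)
        = g k R - Real.log R * r k := fun k => by
      rw [hl _ (hc k)]; simp only [g]; ring
    -- The matching moments cancel the divergent terms of orders `R² log R`, `R²`, `R` and `log R`.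
    simp only [b1, b2, Finset.sum_add_distrib, Finset.sum_sub_distrib, ← Finset.mul_sum, h0, h1,
      h2, F]
    ring
  have hfin := le_of_tendsto hlim (by
    filter_upwards [eventually_gt_atTop 0] with R hR using hFle R hR)
  have c1 : ∑ i, w i * (t i ^ 2 / 2 * Real.log (t i) + (-t i ^ 2 / 4))
      = 1 / 2 * ∑ i, w i * (t i ^ 2 * Real.log (t i)) - 1 / 4 * ∑ i, w i * t i ^ 2 := by
    rw [Finset.mul_sum, Finset.mul_sum, ← Finset.sum_sub_distrib]
    exact Finset.sum_congr rfl fun i _ => by ring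
  have c2 : ∑ k, r k * (0 - Real.log (c k) + 0 - 1)
      = -(1 / 2) * ∑ k, r k * (2 * Real.log (c k) + 3) + 1 / 2 * ∑ k, r k := by
    rw [Finset.mul_sum, Finset.mul_sum, ← Finset.sum_add_distrib]
    exact Finset.sum_congr rfl fun i _ => by ring
  rw [c1, c2, h2] at hfin
  linarith

/-! ### Trace bounds and the log-determinant of a block matrix. -/

/-- The squared Hilbert–Schmidt norm. -/
noncomputable def hsNormSq (Y : Matrix ι κ ℂ) : ℝ := ∑ i, ∑ j, Complex.normSq (Y i j)

theorem re_trace_conjTranspose_mul_diagonal_mul_diagonal (G : Matrix ι κ ℂ) (d : ι → ℝ)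
    (e : κ → ℝ) :
    (Gᴴ * realDiagonal d * G * realDiagonal e).trace.re
      = ∑ i, ∑ j, d i * e j * Complex.normSq (G i j) := by
  rw [Matrix.trace, Complex.re_sum, Finset.sum_comm]
  refine Finset.sum_congr rfl fun j _ => ?_
  rw [Matrix.diag_apply, realDiagonal, realDiagonal, Matrix.mul_diagonal, Matrix.mul_apply,
    Finset.sum_mul, Complex.re_sum]
  refine Finset.sum_congr rfl fun i _ => ?_
  rw [Matrix.mul_diagonal, Matrix.conjTranspose_apply, Complex.star_def,
    show (starRingEnd ℂ) (G i j) * (d i : ℂ) * G i j * (e j : ℂ)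
      = ((d i * e j : ℝ) : ℂ) * ((starRingEnd ℂ) (G i j) * G i j) by push_cast; ring,
    ← Complex.normSq_eq_conj_mul_self, ← Complex.ofReal_mul, Complex.ofReal_re]

theorem hsNormSq_eq_trace (Y : Matrix ι κ ℂ) : hsNormSq Y = (Yᴴ * Y).trace.re := by
  have := re_trace_conjTranspose_mul_diagonal_mul_diagonal Y (fun _ => 1) (fun _ => 1)
  simp only [realDiagonal_one, Matrix.mul_one, one_mul] at this
  exact this.symm

omit [DecidableEq ι] [DecidableEq κ] in
theorem trace_mul_unitary_conj {U : Matrix ι ι ℂ} {V : Matrix κ κ ℂ} (Y : Matrix ι κ ℂ)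
    (D : Matrix ι ι ℂ) (E : Matrix κ κ ℂ) :
    (Yᴴ * (U * D * Uᴴ) * Y * (V * E * Vᴴ)).trace
      = ((Uᴴ * Y * V)ᴴ * D * (Uᴴ * Y * V) * E).trace := by
  have : Yᴴ * (U * D * Uᴴ) * Y * (V * E * Vᴴ) = (Yᴴ * U * D * Uᴴ * Y * V * E) * Vᴴ := by
    simp only [Matrix.mul_assoc]
  rw [this, Matrix.trace_mul_comm]
  simp only [Matrix.conjTranspose_mul, Matrix.conjTranspose_conjTranspose, Matrix.mul_assoc]

theorem exists_posDef_diagonalization {A : Matrix ι ι ℂ} (hA : A.PosDef) :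
    ∃ (U : Matrix ι ι ℂ) (d : ι → ℝ), (∀ i, 0 < d i) ∧ A = U * realDiagonal d * Uᴴ ∧
      A⁻¹ = U * realDiagonal (fun i => (d i)⁻¹) * Uᴴ ∧ 1 = U * realDiagonal (fun _ => 1) * Uᴴ := by
  obtain ⟨U, hU, hU', h⟩ := exists_unitary_diagonalization hA.1
  refine ⟨U, hA.1.eigenvalues, hA.eigenvalues_pos, h, ?_, by rw [realDiagonal_one, mul_one, hU']⟩
  have h1 : U * realDiagonal hA.1.eigenvalues * Uᴴ
      * (U * realDiagonal (fun i => (hA.1.eigenvalues i)⁻¹) * Uᴴ) = 1 := by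
    have : U * realDiagonal hA.1.eigenvalues * Uᴴ
        * (U * realDiagonal (fun i => (hA.1.eigenvalues i)⁻¹) * Uᴴ)
        = U * realDiagonal hA.1.eigenvalues * (Uᴴ * U)
          * realDiagonal (fun i => (hA.1.eigenvalues i)⁻¹) * Uᴴ := by
      simp only [mul_assoc]
    rw [this, hU, mul_one, mul_assoc U, realDiagonal_mul]
    simp only [mul_inv_cancel₀ (hA.eigenvalues_pos _).ne', realDiagonal_one, mul_one, hU']
  exact Matrix.inv_eq_right_inv ((congrArg (· * _) h).trans h1)

/-- The trace form of `1 / (p q) ≥ 3 - p - q`. -/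
theorem re_trace_inv_mul_inv_ge {A : Matrix ι ι ℂ} {B : Matrix κ κ ℂ} (hA : A.PosDef)
    (hB : B.PosDef) (Y : Matrix ι κ ℂ) :
    3 * (Yᴴ * Y).trace.re - (Yᴴ * A * Y).trace.re - (Yᴴ * Y * B).trace.re
      ≤ (Yᴴ * A⁻¹ * Y * B⁻¹).trace.re := by
  obtain ⟨U, d, hd, h1, h2, h3⟩ := exists_posDef_diagonalization hA
  obtain ⟨V, e, he, g1, g2, g3⟩ := exists_posDef_diagonalization hB
  have t1 : (Yᴴ * Y).trace.re = ∑ i, ∑ j, Complex.normSq ((Uᴴ * Y * V) i j) := by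
    have : Yᴴ * Y = Yᴴ * (1 : Matrix ι ι ℂ) * Y * (1 : Matrix κ κ ℂ) := by simp
    rw [this, g3, h3, trace_mul_unitary_conj, re_trace_conjTranspose_mul_diagonal_mul_diagonal]
    simp
  have t2 : (Yᴴ * A * Y).trace.re = ∑ i, ∑ j, d i * Complex.normSq ((Uᴴ * Y * V) i j) := by
    have : Yᴴ * A * Y = Yᴴ * A * Y * (1 : Matrix κ κ ℂ) := by simp
    rw [this, g3, h1, trace_mul_unitary_conj, re_trace_conjTranspose_mul_diagonal_mul_diagonal]
    simp
  have t3 : (Yᴴ * Y * B).trace.re = ∑ i, ∑ j, e j * Complex.normSq ((Uᴴ * Y * V) i j) := by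
    have : Yᴴ * Y * B = Yᴴ * (1 : Matrix ι ι ℂ) * Y * B := by simp
    rw [this, g1, h3, trace_mul_unitary_conj, re_trace_conjTranspose_mul_diagonal_mul_diagonal]
    simp
  rw [t1, t2, t3, h2, g2, trace_mul_unitary_conj, re_trace_conjTranspose_mul_diagonal_mul_diagonal,
    Finset.mul_sum, ← Finset.sum_sub_distrib, ← Finset.sum_sub_distrib]
  refine Finset.sum_le_sum fun i _ => ?_
  rw [Finset.mul_sum, ← Finset.sum_sub_distrib, ← Finset.sum_sub_distrib]
  refine Finset.sum_le_sum fun j _ => ?_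
  rw [← sub_mul, ← sub_mul]
  refine mul_le_mul_of_nonneg_right ?_ (Complex.normSq_nonneg _)
  have hp := hd i
  have hq := he j
  -- In the eigenbases of `A` and `B` only the scalar bound is left, the arithmetic-geometric mean
  -- inequality for `p`, `q` and `1 / (p q)`.
  rw [← mul_inv, ← one_div, le_div_iff₀ (by positivity)]
  nlinarith [mul_nonneg hp.le (sq_nonneg (e j - 1)), mul_nonneg hq.le (sq_nonneg (d i - 1)),
    sq_nonneg (d i * e j - 1), mul_pos hp hq, sq_nonneg (d i - e j),
    mul_nonneg (add_pos hp hq).le (sq_nonneg (d i - e j)),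
    mul_nonneg (add_nonneg (add_pos hp hq).le zero_le_one) (sq_nonneg (d i + e j - 2))]

/-- Rescaling by the diagonal matrices `A_kk^(-1/2)` and `B_kk^(-1/2)` makes both diagonals equal to
`1`. The bound `3 - p - q` then traces to `3 - 1 - 1 = 1` times the sum of the squares of the
rescaled `y k`. -/
theorem sum_sq_div_diag_le {A B : Matrix ι ι ℂ} (hA : A.PosDef) (hB : B.PosDef) (y : ι → ℝ) :
    ∑ k, y k ^ 2 / ((A k k).re * (B k k).re)
      ≤ (realDiagonal y * A⁻¹ * realDiagonal y * B⁻¹).trace.re := by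
  have hsc : ∀ {A : Matrix ι ι ℂ} (hA : A.PosDef), ∃ (a : ι → ℝ) (D D' : Matrix ι ι ℂ),
      (∀ k, a k * a k * (A k k).re = 1) ∧ D = realDiagonal a ∧ D * D' = 1 ∧ D' * D = 1 ∧
      (D * A * D).PosDef ∧ (D * A * D)⁻¹ = D' * A⁻¹ * D' := by
    intro A hA
    have hpos : ∀ k, 0 < (A k k).re := fun k => (Complex.lt_def.1 (hA.diag_pos (i := k))).1
    have h1 : ∀ k, (Real.sqrt (A k k).re)⁻¹ * Real.sqrt (A k k).re = 1 := fun k =>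
      inv_mul_cancel₀ (Real.sqrt_ne_zero'.2 (hpos k))
    have hDD : realDiagonal (fun k => (Real.sqrt (A k k).re)⁻¹)
        * realDiagonal (fun k => Real.sqrt (A k k).re) = 1 := by
      rw [realDiagonal_mul]; simp only [h1, realDiagonal_one]
    refine ⟨fun k => (Real.sqrt (A k k).re)⁻¹, _, realDiagonal fun k => Real.sqrt (A k k).re,
      fun k => ?_, rfl, hDD, mul_eq_one_comm.1 hDD, ?_, ?_⟩
    · rw [← mul_inv, Real.mul_self_sqrt (hpos k).le, inv_mul_cancel₀ (hpos k).ne']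
    · have := hA.conjTranspose_mul_mul_same (B := realDiagonal fun k => (Real.sqrt (A k k).re)⁻¹)
        (Matrix.mulVec_injective_of_isUnit (IsUnit.of_mul_eq_one _ hDD))
      rwa [realDiagonal_conjTranspose] at this
    · rw [Matrix.mul_inv_rev, Matrix.mul_inv_rev, Matrix.inv_eq_right_inv hDD, mul_assoc]
  obtain ⟨a, D, D', ha, hD, hDD, hDD', hA', hAi⟩ := hsc hA
  obtain ⟨b, E, E', hb, hE, hEE, hEE', hB', hBi⟩ := hsc hB
  have hY : D * realDiagonal y * E = realDiagonal fun k => a k * y k * b k := by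
    rw [hD, hE, realDiagonal_mul, realDiagonal_mul]
  have h := re_trace_inv_mul_inv_ge hA' hB' (D * realDiagonal y * E)
  have hYH : (D * realDiagonal y * E)ᴴ = E * realDiagonal y * D := by
    rw [Matrix.conjTranspose_mul, Matrix.conjTranspose_mul, hD, hE, realDiagonal_conjTranspose,
      realDiagonal_conjTranspose, realDiagonal_conjTranspose, mul_assoc]
  have hR : ((D * realDiagonal y * E)ᴴ * (D * A * D)⁻¹ * (D * realDiagonal y * E)
      * (E * B * E)⁻¹).trace = (realDiagonal y * A⁻¹ * realDiagonal y * B⁻¹).trace := by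
    rw [hYH, hAi, hBi]
    have : E * realDiagonal y * D * (D' * A⁻¹ * D') * (D * realDiagonal y * E) * (E' * B⁻¹ * E')
        = E * (realDiagonal y * (D * D') * A⁻¹ * (D' * D) * realDiagonal y * (E * E') * B⁻¹)
          * E' := by
      simp only [mul_assoc]
    rw [this, hDD, hDD', hEE, Matrix.trace_mul_comm, ← mul_assoc, hEE', one_mul]
    simp only [mul_one]
  rw [hR, hY, realDiagonal_conjTranspose] at h
  refine le_trans (le_of_eq ?_) h
  have tr1 : ∀ (u v : ι → ℝ) (C : Matrix ι ι ℂ),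
      (realDiagonal u * C * realDiagonal v).trace.re = ∑ k, u k * v k * (C k k).re := by
    intro u v C
    rw [Matrix.trace, Complex.re_sum]
    refine Finset.sum_congr rfl fun k _ => ?_
    rw [Matrix.diag_apply, realDiagonal, realDiagonal, Matrix.mul_diagonal, Matrix.diagonal_mul,
      mul_right_comm, ← Complex.ofReal_mul, Complex.re_ofReal_mul]
  have tr2 : ∀ (u v : ι → ℝ) (C : Matrix ι ι ℂ),
      (realDiagonal u * realDiagonal v * C).trace.re = ∑ k, u k * v k * (C k k).re := by
    intro u v C
    rw [Matrix.trace, Complex.re_sum]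
    refine Finset.sum_congr rfl fun k _ => ?_
    rw [Matrix.diag_apply, realDiagonal_mul, realDiagonal, Matrix.diagonal_mul,
      Complex.re_ofReal_mul]
  have tr3 : ∀ (u v : ι → ℝ),
      (realDiagonal u * realDiagonal v).trace.re = ∑ k, u k * v k := by
    intro u v
    have := tr1 u v 1
    simpa using this
  have dd : ∀ (u : ι → ℝ) (C : Matrix ι ι ℂ) k,
      ((realDiagonal u * C * realDiagonal u) k k).re = u k * u k * (C k k).re := by
    intro u C k
    rw [realDiagonal, Matrix.mul_diagonal, Matrix.diagonal_mul,
      mul_right_comm, ← Complex.ofReal_mul, Complex.re_ofReal_mul]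
  rw [tr1, tr2, tr3, hD, hE]
  simp only [dd, ha, hb, mul_one]
  rw [Finset.mul_sum, ← Finset.sum_sub_distrib, ← Finset.sum_sub_distrib]
  refine Finset.sum_congr rfl fun k _ => ?_
  have e1 : ((A k k).re * (B k k).re)⁻¹ = a k * a k * (b k * b k) := by
    rw [mul_inv, ← eq_inv_of_mul_eq_one_left (ha k), ← eq_inv_of_mul_eq_one_left (hb k)]
  rw [div_eq_mul_inv, e1]
  ring

-- Nonnegativity of the `2 × 2` principal minor on the indices `inl k`, `inr k`.
omit [Fintype ι] in
theorem sq_le_re_mul_re_of_posSemidef {A D : Matrix ι ι ℂ} {y : ι → ℝ}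
    (h : (Matrix.fromBlocks A (realDiagonal y) (realDiagonal y) D).PosSemidef) (k : ι) :
    y k ^ 2 ≤ (A k k).re * (D k k).re ∧ 0 ≤ (A k k).re ∧ 0 ≤ (D k k).re := by
  have h2 := h.submatrix ![Sum.inl k, Sum.inr k]
  have ha := h.diag_nonneg (i := Sum.inl k)
  have hd := h.diag_nonneg (i := Sum.inr k)
  have hdet := h2.det_nonneg
  rw [Matrix.det_fin_two] at hdet
  simp only [Matrix.submatrix_apply, Matrix.cons_val_zero, Matrix.cons_val_one,
    Matrix.fromBlocks_apply₁₁, Matrix.fromBlocks_apply₁₂, Matrix.fromBlocks_apply₂₁,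
    Matrix.fromBlocks_apply₂₂, realDiagonal, Matrix.diagonal_apply_eq] at ha hd hdet
  have ea := Complex.eq_re_of_ofReal_le ha
  have ed := Complex.eq_re_of_ofReal_le hd
  rw [Complex.le_def] at ha hd
  refine ⟨?_, ha.1, hd.1⟩
  rw [ea, ed, ← Complex.ofReal_mul, ← Complex.ofReal_mul, ← Complex.ofReal_sub,
    Complex.zero_le_real] at hdet
  nlinarith

omit [Fintype ι] in
theorem smul_one_add_posDef {A : Matrix ι ι ℂ} (hA : A.PosSemidef) {s : ℝ} (hs : 0 < s) :
    ((s : ℂ) • (1 : Matrix ι ι ℂ) + A).PosDef :=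
  (Matrix.PosDef.one.smul (by exact_mod_cast hs)).add_posSemidef hA

/-- The determinant is `det X * det Q` for the Schur complement `Q = Z - y X⁻¹ y`. The tangent bound
for `log det` at `Z` loses exactly the trace of `y X⁻¹ y Z⁻¹`, which `sum_sq_div_diag_le` bounds
from below. -/
theorem log_det_fromBlocks_le {X Z : Matrix ι ι ℂ} {y : ι → ℝ}
    (hM : (Matrix.fromBlocks X (realDiagonal y) (realDiagonal y) Z).PosDef) :
    Real.log (Matrix.fromBlocks X (realDiagonal y) (realDiagonal y) Z).det.re
        + ∑ k, y k ^ 2 / ((X k k).re * (Z k k).re)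
      ≤ Real.log X.det.re + Real.log Z.det.re := by
  have hX : X.PosDef := hM.submatrix (e := Sum.inl) Sum.inl_injective
  have hZ : Z.PosDef := hM.submatrix (e := Sum.inr) Sum.inr_injective
  let _ := hX.isUnit.invertible
  set Q := Z - realDiagonal y * X⁻¹ * realDiagonal y with hQ
  have hdet : (Matrix.fromBlocks X (realDiagonal y) (realDiagonal y) Z).det = X.det * Q.det := by
    rw [Matrix.det_fromBlocks₁₁, Matrix.invOf_eq_nonsing_inv]
  have hQps : Q.PosSemidef := by
    have := (Matrix.PosDef.fromBlocks₁₁ (realDiagonal y) Z hX).1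
      (by rw [realDiagonal_conjTranspose]; exact hM.posSemidef)
    rwa [realDiagonal_conjTranspose] at this
  have hMd := hM.det_pos
  have hXd := hX.det_pos
  have hQd : Q.det ≠ 0 := fun h => by rw [hdet, h, mul_zero] at hMd; exact lt_irrefl _ hMd
  have hQp : Q.PosDef := hQps.posDef_iff_isUnit.2 ((Matrix.isUnit_iff_isUnit_det _).2 hQd.isUnit)
  have hQd' := hQp.det_pos
  have e1 := Complex.eq_re_of_ofReal_le hXd.le
  have e2 := Complex.eq_re_of_ofReal_le hQd'.le
  have p1 := (Complex.lt_def.1 hXd).1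
  have p2 := (Complex.lt_def.1 hQd').1
  have h1 := log_det_le hZ hQp
  have h2 := sum_sq_div_diag_le hX hZ y
  rw [hdet, e1, e2, ← Complex.ofReal_mul, Complex.ofReal_re, Real.log_mul p1.ne' p2.ne']
  have h3 : (Z⁻¹ * Q).trace.re = Fintype.card ι
      - (realDiagonal y * X⁻¹ * realDiagonal y * Z⁻¹).trace.re := by
    rw [hQ, mul_sub, Matrix.trace_sub, Matrix.nonsing_inv_mul _ hZ.det_pos.ne'.isUnit,
      Matrix.trace_one, Matrix.trace_mul_comm]
    simp
  rw [Complex.ofReal_re]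
  linarith

omit [DecidableEq ι] in
theorem trace_fromBlocks (A B C D : Matrix ι ι ℂ) :
    (Matrix.fromBlocks A B C D).trace = A.trace + D.trace := by
  simp [Matrix.trace, Fintype.sum_sum_type]

theorem spectralSum_id {M : Matrix ι ι ℂ} (hM : M.IsHermitian) :
    spectralSum (fun t => t) M = M.trace.re := by
  rw [spectralSum_isHermitian _ hM, hM.trace_eq_sum_eigenvalues]; simp

/-- The second order bound on `Tr (M² ln M)` in terms of the off-diagonal block. -/
theorem spectralSum_fromBlocks_le {X Z : Matrix ι ι ℂ} {y : ι → ℝ}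
    (hM : (Matrix.fromBlocks X (realDiagonal y) (realDiagonal y) Z).PosSemidef) :
    spectralSum (fun t => t ^ 2 * Real.log t)
        (Matrix.fromBlocks X (realDiagonal y) (realDiagonal y) Z)
      ≤ spectralSum (fun t => t ^ 2 * Real.log t) X + spectralSum (fun t => t ^ 2 * Real.log t) Z
        + ∑ k, y k ^ 2 * (2 * Real.log (((X k k).re + (Z k k).re) / 2) + 3) := by
  set M := Matrix.fromBlocks X (realDiagonal y) (realDiagonal y) Z with hMdef
  have hX : X.PosSemidef := hM.submatrix Sum.inl
  have hZ : Z.PosSemidef := hM.submatrix Sum.inr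
  have hxz := sq_le_re_mul_re_of_posSemidef hM
  -- The eigenvalues of `M` get weight `1`, those of `X` and `Z` weight `-1`. The moments of orders
  -- `0` and `1` cancel, and the second one is `2 ∑ y k ^ 2`.
  let w : (ι ⊕ ι) ⊕ (ι ⊕ ι) → ℝ := Sum.elim (fun _ => 1) fun _ => -1
  let t : (ι ⊕ ι) ⊕ (ι ⊕ ι) → ℝ :=
    Sum.elim hM.1.eigenvalues (Sum.elim hX.1.eigenvalues hZ.1.eigenvalues)
  have hsum : ∀ f : ℝ → ℝ, ∑ i, w i * f (t i)
      = spectralSum f M - spectralSum f X - spectralSum f Z := by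
    intro f
    simp only [Fintype.sum_sum_type, w, t, Sum.elim_inl, Sum.elim_inr, one_mul, neg_one_mul,
      Finset.sum_neg_distrib, spectralSum_isHermitian f hM.1, spectralSum_isHermitian f hX.1,
      spectralSum_isHermitian f hZ.1]
    ring
  have key := sum_sq_mul_log_le (w := w) (t := t) (r := fun k => y k ^ 2)
    (c := fun k => ((X k k).re + (Z k k).re) / 2) ?_ ?_ ?_ ?_ ?_ ?_ ?_
  · have := hsum fun t => t ^ 2 * Real.log t
    rw [this] at key
    linarith
  · rintro (i | i | i)
    · exact hM.eigenvalues_nonneg i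
    · exact hX.eigenvalues_nonneg i
    · exact hZ.eigenvalues_nonneg i
  · intro k; have := hxz k; linarith [this.2.1, this.2.2]
  · intro k hk
    have := hxz k
    nlinarith [this.1, this.2.1, this.2.2, sq_nonneg (y k)]
  · intro s hs
    rw [hsum fun t => Real.log (s + t), spectralSum_log_add hM hs, spectralSum_log_add hX hs,
      spectralSum_log_add hZ hs]
    have hblock : (s : ℂ) • (1 : Matrix (ι ⊕ ι) (ι ⊕ ι) ℂ) + M
        = Matrix.fromBlocks ((s : ℂ) • 1 + X) (realDiagonal y) (realDiagonal y)
          ((s : ℂ) • 1 + Z) := by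
      rw [hMdef, ← Matrix.fromBlocks_one, Matrix.fromBlocks_smul, Matrix.fromBlocks_add]
      simp
    have hpd := smul_one_add_posDef hM hs
    rw [hblock] at hpd ⊢
    have h1 := log_det_fromBlocks_le hpd
    -- The product of the two diagonal entries is at most the square of their mean; this produces
    -- the double pole that `sum_sq_mul_log_le` integrates.
    have h2 : ∑ k, y k ^ 2 / (s + ((X k k).re + (Z k k).re) / 2) ^ 2
        ≤ ∑ k, y k ^ 2 / ((((s : ℂ) • 1 + X) k k).re * (((s : ℂ) • 1 + Z) k k).re) := by
      refine Finset.sum_le_sum fun k _ => ?_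
      have := hxz k
      have e1 : (((s : ℂ) • 1 + X) k k).re = s + (X k k).re := by simp
      have e2 : (((s : ℂ) • 1 + Z) k k).re = s + (Z k k).re := by simp
      have p1 : 0 < s + (X k k).re := by linarith [this.2.1]
      have p2 : 0 < s + (Z k k).re := by linarith [this.2.2]
      rw [e1, e2]
      refine div_le_div_of_nonneg_left (sq_nonneg _) (by positivity) ?_
      nlinarith [sq_nonneg ((X k k).re - (Z k k).re)]
    linarith
  · simp [w]
  · rw [hsum fun t => t, spectralSum_id hM.1, spectralSum_id hX.1, spectralSum_id hZ.1, hMdef]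
    simp [trace_fromBlocks]
  · have hsq : ∀ {κ : Type _} [Fintype κ] [DecidableEq κ] {N : Matrix κ κ ℂ} (hN : N.IsHermitian),
        spectralSum (fun t => t ^ 2) N = (N * N).trace.re := by
      intro κ _ _ N hN
      have h2 : (N * N).IsHermitian := by rw [Matrix.IsHermitian, Matrix.conjTranspose_mul, hN]
      rw [← spectralSum_id h2, spectralSum_mul_self _ hN]
      simp only [pow_two]
    rw [hsum fun t => t ^ 2, hsq hM.1, hsq hX.1, hsq hZ.1, hMdef, Matrix.fromBlocks_multiply,
      trace_fromBlocks]
    simp only [Matrix.trace_add, Complex.add_re, realDiagonal_mul]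
    have : (realDiagonal fun i => y i * y i).trace.re = ∑ k, y k ^ 2 := by
      simp [realDiagonal, Matrix.trace, pow_two]
    rw [this]
    ring

/-! ### Entropy of a positive block matrix. -/

/-- `Tr (|Y|² ln |Y|²)`. -/
noncomputable def hsEntropy (Y : Matrix ι ι ℂ) : ℝ :=
  spectralSum (fun t => t * Real.log t) (Yᴴ * Y)

/-- `Tr (|Y|² ln |Y|²) - ‖Y‖² ln ‖Y‖²` for the Hilbert–Schmidt norm. -/
noncomputable def relEntropy (Y : Matrix ι ι ℂ) : ℝ :=
  hsEntropy Y - hsNormSq Y * Real.log (hsNormSq Y)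

theorem hsEntropy_conjTranspose (Y : Matrix ι ι ℂ) : hsEntropy Yᴴ = hsEntropy Y := by
  rw [hsEntropy, hsEntropy, Matrix.conjTranspose_conjTranspose, spectralSum_mul_comm]

omit [DecidableEq ι] [DecidableEq κ] in
theorem hsNormSq_conjTranspose (Y : Matrix ι κ ℂ) : hsNormSq Yᴴ = hsNormSq Y := by
  rw [hsNormSq, hsNormSq, Finset.sum_comm]
  simp [Matrix.conjTranspose_apply]

theorem relEntropy_conjTranspose (Y : Matrix ι ι ℂ) : relEntropy Yᴴ = relEntropy Y := by
  rw [relEntropy, relEntropy, hsEntropy_conjTranspose, hsNormSq_conjTranspose]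

theorem hsEntropy_unitary_mul {U V : Matrix ι ι ℂ} (hU : Uᴴ * U = 1) (hV : V * Vᴴ = 1)
    (Y : Matrix ι ι ℂ) : hsEntropy (U * Y * V) = hsEntropy Y := by
  have : (U * Y * V)ᴴ * (U * Y * V) = Vᴴ * (Yᴴ * (Uᴴ * U) * Y) * V := by
    simp only [Matrix.conjTranspose_mul, mul_assoc]
  rw [hsEntropy, hsEntropy, this, spectralSum_mul_comm, ← mul_assoc, hV, hU, mul_one, one_mul]

theorem hsNormSq_unitary_mul {U V : Matrix ι ι ℂ} (hU : Uᴴ * U = 1) (hV : V * Vᴴ = 1)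
    (Y : Matrix ι ι ℂ) : hsNormSq (U * Y * V) = hsNormSq Y := by
  have : (U * Y * V)ᴴ * (U * Y * V) = Vᴴ * (Yᴴ * (Uᴴ * U) * Y) * V := by
    simp only [Matrix.conjTranspose_mul, mul_assoc]
  rw [hsNormSq_eq_trace, hsNormSq_eq_trace, this, Matrix.trace_mul_comm, ← mul_assoc, hV, hU,
    mul_one, one_mul]

theorem relEntropy_unitary_mul {U V : Matrix ι ι ℂ} (hU : Uᴴ * U = 1) (hV : V * Vᴴ = 1)
    (Y : Matrix ι ι ℂ) : relEntropy (U * Y * V) = relEntropy Y := by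
  rw [relEntropy, relEntropy, hsEntropy_unitary_mul hU hV, hsNormSq_unitary_mul hU hV]

theorem hsEntropy_realDiagonal (y : ι → ℝ) :
    hsEntropy (realDiagonal y) = ∑ k, y k ^ 2 * Real.log (y k ^ 2) := by
  rw [hsEntropy, realDiagonal_conjTranspose, realDiagonal_mul, spectralSum_realDiagonal]
  simp only [pow_two]

theorem hsNormSq_realDiagonal (y : ι → ℝ) : hsNormSq (realDiagonal y) = ∑ k, y k ^ 2 := by
  rw [hsNormSq_eq_trace, realDiagonal_conjTranspose, realDiagonal_mul]
  simp [realDiagonal, Matrix.trace, pow_two]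

omit [DecidableEq ι] [DecidableEq κ] in
theorem hsNormSq_nonneg (Y : Matrix ι κ ℂ) : 0 ≤ hsNormSq Y :=
  Finset.sum_nonneg fun _ _ => Finset.sum_nonneg fun _ _ => Complex.normSq_nonneg _

/-- Negative eigenvalues are harmless, since `Real.log t` is `log |t|`. -/
theorem hsEntropy_isHermitian {M : Matrix ι ι ℂ} (hM : M.IsHermitian) :
    hsEntropy M = 2 * spectralSum (fun t => t ^ 2 * Real.log t) M := by
  rw [hsEntropy, hM, spectralSum_mul_self _ hM, spectralSum_isHermitian _ hM,
    spectralSum_isHermitian _ hM, Finset.mul_sum]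
  refine Finset.sum_congr rfl fun i _ => ?_
  rw [← pow_two, Real.log_pow]
  push_cast
  ring

omit [DecidableEq ι] in
theorem hsNormSq_fromBlocks (A B C D : Matrix ι ι ℂ) :
    hsNormSq (Matrix.fromBlocks A B C D)
      = hsNormSq A + hsNormSq B + hsNormSq C + hsNormSq D := by
  simp only [hsNormSq, Fintype.sum_sum_type, Matrix.fromBlocks_apply₁₁, Matrix.fromBlocks_apply₁₂,
    Matrix.fromBlocks_apply₂₁, Matrix.fromBlocks_apply₂₂, Finset.sum_add_distrib]
  ring

omit [DecidableEq ι] [DecidableEq κ] in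
theorem hsNormSq_add_le (X Z : Matrix ι κ ℂ) :
    hsNormSq (X + Z) ≤ (Real.sqrt (hsNormSq X) + Real.sqrt (hsNormSq Z)) ^ 2 := by
  have h : ∀ W : Matrix ι κ ℂ, hsNormSq W = ∑ p : ι × κ, ‖W p.1 p.2‖ ^ 2 := fun W => by
    rw [Fintype.sum_prod_type]; simp only [hsNormSq, Complex.normSq_eq_norm_sq]
  have hcs := Real.sum_mul_le_sqrt_mul_sqrt Finset.univ (fun p : ι × κ => ‖X p.1 p.2‖)
    (fun p => ‖Z p.1 p.2‖)
  rw [← h, ← h] at hcs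
  rw [add_sq, Real.sq_sqrt (hsNormSq_nonneg X), Real.sq_sqrt (hsNormSq_nonneg Z)]
  have : hsNormSq (X + Z) ≤ hsNormSq X + hsNormSq Z
      + 2 * ∑ p : ι × κ, ‖X p.1 p.2‖ * ‖Z p.1 p.2‖ := by
    rw [h, h, h, Finset.mul_sum, ← Finset.sum_add_distrib, ← Finset.sum_add_distrib]
    refine Finset.sum_le_sum fun p _ => ?_
    have h1 := norm_add_le (X p.1 p.2) (Z p.1 p.2)
    calc _ ≤ (‖X p.1 p.2‖ + ‖Z p.1 p.2‖) ^ 2 := by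
          rw [Matrix.add_apply]; gcongr
      _ = _ := by ring
  linarith

omit [DecidableEq ι] in
theorem sum_diag_sq_le_hsNormSq (X : Matrix ι ι ℂ) : ∑ k, (X k k).re ^ 2 ≤ hsNormSq X := by
  refine Finset.sum_le_sum fun k _ => ?_
  refine le_trans ?_ (Finset.single_le_sum (f := fun j => Complex.normSq (X k j))
    (fun j _ => Complex.normSq_nonneg _) (Finset.mem_univ k))
  rw [Complex.normSq_apply]
  nlinarith [mul_self_nonneg (X k k).im]

/-- The bound on `Tr M² ln M` still involves every diagonal entry of `X` and `Z`. Jensen's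
inequality with weights `y k ^ 2` merges them into `((x + z) / 2)²`, and the scalar inequality
applies with `r = ∑ y k ^ 2`. -/
theorem relEntropy_fromBlocks_realDiagonal_le {X Z : Matrix ι ι ℂ} {y : ι → ℝ}
    (hM : (Matrix.fromBlocks X (realDiagonal y) (realDiagonal y) Z).PosSemidef) :
    relEntropy (Matrix.fromBlocks X (realDiagonal y) (realDiagonal y) Z)
        + Real.log 2 * hsNormSq (Matrix.fromBlocks X (realDiagonal y) (realDiagonal y) Z)
      ≤ relEntropy X + relEntropy Z + 2 * relEntropy (realDiagonal y)
        + (Real.sqrt (hsNormSq X) - Real.sqrt (hsNormSq Z)) ^ 2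
        + 4 * hsNormSq (realDiagonal y) := by
  have hX : X.PosSemidef := hM.submatrix Sum.inl
  have hZ : Z.PosSemidef := hM.submatrix Sum.inr
  have hxz := sq_le_re_mul_re_of_posSemidef hM
  set x := Real.sqrt (hsNormSq X) with hx
  set z := Real.sqrt (hsNormSq Z) with hz
  have hx0 : 0 ≤ x := Real.sqrt_nonneg _
  have hz0 : 0 ≤ z := Real.sqrt_nonneg _
  have hx2 : hsNormSq X = x ^ 2 := (Real.sq_sqrt (hsNormSq_nonneg X)).symm
  have hz2 : hsNormSq Z = z ^ 2 := (Real.sq_sqrt (hsNormSq_nonneg Z)).symm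
  have hcs : ∑ k, (X k k).re * (Z k k).re ≤ x * z :=
    (Real.sum_mul_le_sqrt_mul_sqrt _ _ _).trans (mul_le_mul
      (Real.sqrt_le_sqrt (sum_diag_sq_le_hsNormSq X))
      (Real.sqrt_le_sqrt (sum_diag_sq_le_hsNormSq Z)) (Real.sqrt_nonneg _) hx0)
  have hP : ∑ k, y k ^ 2 ≤ x * z := (Finset.sum_le_sum fun k _ => (hxz k).1).trans hcs
  have hQ : ∑ k, (((X k k).re + (Z k k).re) / 2) ^ 2 ≤ ((x + z) / 2) ^ 2 := by
    have e : ∑ k, (((X k k).re + (Z k k).re) / 2) ^ 2 = 1 / 4 * ∑ k, (X k k).re ^ 2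
        + 1 / 4 * ∑ k, (Z k k).re ^ 2 + 1 / 2 * ∑ k, (X k k).re * (Z k k).re := by
      rw [Finset.mul_sum, Finset.mul_sum, Finset.mul_sum, ← Finset.sum_add_distrib,
        ← Finset.sum_add_distrib]
      exact Finset.sum_congr rfl fun k _ => by ring
    have h1 := sum_diag_sq_le_hsNormSq X
    have h2 := sum_diag_sq_le_hsNormSq Z
    rw [e]
    nlinarith
  have h1 := spectralSum_fromBlocks_le hM
  have h2 := sum_mul_log_sub_log_le (p := fun k => y k ^ 2)
    (b := fun k => (((X k k).re + (Z k k).re) / 2) ^ 2) (fun k => sq_nonneg _)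
    (fun k => sq_nonneg _) (fun k hk => by
      have := hxz k
      have h0 : ((X k k).re + (Z k k).re) / 2 = 0 := pow_eq_zero_iff (two_ne_zero) |>.1 hk
      nlinarith [this.1, this.2.1, this.2.2, sq_nonneg (y k)]) hQ
  have h3 := qubit_entropy_bound hx0 hz0 (Finset.sum_nonneg fun k _ => sq_nonneg (y k)) hP
  have e1 : ∑ k, y k ^ 2 * (2 * Real.log (((X k k).re + (Z k k).re) / 2) + 3)
      = ∑ k, y k ^ 2 * (Real.log ((((X k k).re + (Z k k).re) / 2) ^ 2) - Real.log (y k ^ 2))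
        + ∑ k, y k ^ 2 * Real.log (y k ^ 2) + 3 * ∑ k, y k ^ 2 := by
    rw [Finset.mul_sum, ← Finset.sum_add_distrib, ← Finset.sum_add_distrib]
    refine Finset.sum_congr rfl fun k _ => ?_
    rw [Real.log_pow (n := 2) (((X k k).re + (Z k k).re) / 2)]
    push_cast
    ring
  rw [relEntropy, relEntropy, relEntropy, relEntropy, hsNormSq_fromBlocks,
    hsEntropy_isHermitian hM.1, hsEntropy_isHermitian hX.1, hsEntropy_isHermitian hZ.1,
    hsEntropy_realDiagonal, hsNormSq_realDiagonal, hx2, hz2]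
  rw [e1] at h1
  set P := ∑ k, y k ^ 2 with hPdef
  have e2 : x ^ 2 + P + P + z ^ 2 = x ^ 2 + z ^ 2 + 2 * P := by ring
  have e3 : (x ^ 2 + z ^ 2 + 2 * P) * Real.log ((x ^ 2 + z ^ 2 + 2 * P) / 2)
      = (x ^ 2 + z ^ 2 + 2 * P) * Real.log (x ^ 2 + z ^ 2 + 2 * P)
        - Real.log 2 * (x ^ 2 + z ^ 2 + 2 * P) := by
    by_cases h0 : x ^ 2 + z ^ 2 + 2 * P = 0
    · rw [h0]; simp
    · rw [Real.log_div h0 two_ne_zero]; ring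
  rw [e2]
  linarith

/-- The entropy of a positive `2 × 2` block matrix is controlled by the entropies of its blocks
and by the Dirichlet form of the qubit that labels the blocks. -/
theorem relEntropy_fromBlocks_le {X Y Z : Matrix ι ι ℂ}
    (hM : (Matrix.fromBlocks X Y Yᴴ Z).PosSemidef) :
    relEntropy (Matrix.fromBlocks X Y Yᴴ Z)
        + Real.log 2 * hsNormSq (Matrix.fromBlocks X Y Yᴴ Z)
      ≤ relEntropy X + relEntropy Z + 2 * relEntropy Y
        + 2 * (hsNormSq (Matrix.fromBlocks X Y Yᴴ Z) - hsNormSq (X + Z) / 2) := by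
  obtain ⟨U, V, y, hU, hU', hV, hV', -, hY⟩ := exists_singularValueDecomposition Y
  set W : Matrix (ι ⊕ ι) (ι ⊕ ι) ℂ := Matrix.fromBlocks U 0 0 V with hW
  have hWH : Wᴴ = Matrix.fromBlocks Uᴴ 0 0 Vᴴ := by
    simp [hW, Matrix.fromBlocks_conjTranspose]
  have hWW : Wᴴ * W = 1 := by
    rw [hWH, hW, Matrix.fromBlocks_multiply, ← Matrix.fromBlocks_one]; simp [hU, hV]
  have hWW' : W * Wᴴ = 1 := mul_eq_one_comm.1 hWW
  have hy : Uᴴ * Y * V = realDiagonal y := by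
    calc Uᴴ * Y * V = (Uᴴ * U) * realDiagonal y * (Vᴴ * V) := by rw [hY]; simp only [mul_assoc]
      _ = _ := by rw [hU, hV, one_mul, mul_one]
  have hy' : Vᴴ * Yᴴ * U = realDiagonal y := by
    rw [← realDiagonal_conjTranspose, ← hy]
    simp only [Matrix.conjTranspose_mul, Matrix.conjTranspose_conjTranspose, mul_assoc]
  have hconj : Wᴴ * Matrix.fromBlocks X Y Yᴴ Z * W
      = Matrix.fromBlocks (Uᴴ * X * U) (realDiagonal y) (realDiagonal y) (Vᴴ * Z * V) := by
    rw [hWH, hW, Matrix.fromBlocks_multiply, Matrix.fromBlocks_multiply]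
    simp [hy, hy']
  have hps : (Wᴴ * Matrix.fromBlocks X Y Yᴴ Z * W).PosSemidef := hM.conjTranspose_mul_mul_same W
  rw [hconj] at hps
  have h := relEntropy_fromBlocks_realDiagonal_le hps
  have hUH : Uᴴᴴ * Uᴴ = 1 := by rw [Matrix.conjTranspose_conjTranspose, hU']
  have hVH : Vᴴᴴ * Vᴴ = 1 := by rw [Matrix.conjTranspose_conjTranspose, hV']
  have hWH' : Wᴴᴴ * Wᴴ = 1 := by rw [Matrix.conjTranspose_conjTranspose, hWW']
  rw [← hconj, relEntropy_unitary_mul hWH' hWW', hsNormSq_unitary_mul hWH' hWW',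
    relEntropy_unitary_mul hUH hU', relEntropy_unitary_mul hVH hV',
    hsNormSq_unitary_mul hUH hU', hsNormSq_unitary_mul hVH hV', ← hy,
    relEntropy_unitary_mul hUH hV', hsNormSq_unitary_mul hUH hV'] at h
  have hadd := hsNormSq_add_le X Z
  have e := hsNormSq_fromBlocks X Y Yᴴ Z
  rw [hsNormSq_conjTranspose] at e
  have hx2 := Real.sq_sqrt (hsNormSq_nonneg X)
  have hz2 := Real.sq_sqrt (hsNormSq_nonneg Z)
  -- By the triangle inequality `‖X + Z‖² ≤ (x + z)²`, so `2 ‖M‖² - ‖X + Z‖² ≥ (x - z)² + 4 ‖Y‖²`.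
  nlinarith

/-! ### The Dirichlet form of a qubit and its behaviour under passage to moduli. -/

omit [DecidableEq ι] in
theorem hsInner_eq_sum (A B : Matrix ι ι ℂ) :
    hsInner A B = ∑ i, ∑ j, (starRingEnd ℂ) (A i j) * B i j := by
  rw [hsInner, Matrix.trace, Finset.sum_comm]
  rfl

theorem hsInner_self_re (A : Matrix ι ι ℂ) : (hsInner A A).re = hsNormSq A :=
  (hsNormSq_eq_trace A).symm

theorem trace_realDiagonal_mul (y : ι → ℝ) (G K : Matrix ι ι ℂ) :
    (realDiagonal y * G * realDiagonal y * Kᴴ).trace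
      = ∑ i, ∑ j, ((y i * y j : ℝ) : ℂ) * (G i j * (starRingEnd ℂ) (K i j)) := by
  refine Finset.sum_congr rfl fun i _ => ?_
  rw [Matrix.diag_apply, Matrix.mul_apply]
  refine Finset.sum_congr rfl fun j _ => ?_
  rw [realDiagonal, Matrix.mul_diagonal, Matrix.diagonal_mul, Matrix.conjTranspose_apply,
    Complex.star_def]
  push_cast
  ring

/-- For `Y = U y V*`, the overlap of `Y` with `S Y S*` is at most the average of the corresponding
overlaps of the moduli `V y V*` and `U y U*`. -/
theorem re_hsInner_conj_le {U V : Matrix ι ι ℂ} {y : ι → ℝ} (hy : ∀ i, 0 ≤ y i)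
    (S : Matrix ι ι ℂ) :
    2 * (hsInner (U * realDiagonal y * Vᴴ) (S * (U * realDiagonal y * Vᴴ) * Sᴴ)).re
      ≤ (hsInner (V * realDiagonal y * Vᴴ) (S * (V * realDiagonal y * Vᴴ) * Sᴴ)).re
        + (hsInner (U * realDiagonal y * Uᴴ) (S * (U * realDiagonal y * Uᴴ) * Sᴴ)).re := by
  have h : ∀ U V : Matrix ι ι ℂ,
      hsInner (U * realDiagonal y * Vᴴ) (S * (U * realDiagonal y * Vᴴ) * Sᴴ)
        = ∑ i, ∑ j, ((y i * y j : ℝ) : ℂ)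
          * ((Uᴴ * S * U) i j * (starRingEnd ℂ) ((Vᴴ * S * V) i j)) := by
    intro U V
    rw [← trace_realDiagonal_mul, hsInner, Matrix.conjTranspose_mul, Matrix.conjTranspose_mul,
      realDiagonal_conjTranspose, Matrix.conjTranspose_conjTranspose, mul_assoc V,
      Matrix.trace_mul_comm, ← mul_assoc, mul_assoc _ _ V]
    simp only [Matrix.conjTranspose_mul, Matrix.conjTranspose_conjTranspose, mul_assoc]
  rw [h, h, h, Complex.re_sum, Complex.re_sum, Complex.re_sum, Finset.mul_sum,
    ← Finset.sum_add_distrib]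
  refine Finset.sum_le_sum fun i _ => ?_
  rw [Complex.re_sum, Complex.re_sum, Complex.re_sum, Finset.mul_sum, ← Finset.sum_add_distrib]
  refine Finset.sum_le_sum fun j _ => ?_
  rw [Complex.re_ofReal_mul, Complex.re_ofReal_mul, Complex.re_ofReal_mul]
  have h0 : 0 ≤ y i * y j := mul_nonneg (hy i) (hy j)
  generalize (Uᴴ * S * U) i j = a
  generalize (Vᴴ * S * V) i j = b
  simp only [Complex.mul_re, Complex.conj_re, Complex.conj_im]
  -- This is `2 Re (a b̄) ≤ |a|² + |b|²` with the nonnegative weight `y i * y j`.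
  nlinarith [mul_nonneg h0 (sq_nonneg (a.re - b.re)), mul_nonneg h0 (sq_nonneg (a.im - b.im))]

/-- The trace over the `k`-th qubit, normalized and tensored with the identity. -/
noncomputable def partialExpectation {n : ℕ} (k : Fin n) (Y : QubitMatrix n) : QubitMatrix n :=
  Matrix.of fun x y => if x k = y k then
    (∑ c, Y (Function.update x k c) (Function.update y k c)) / 2 else 0

/-- The Dirichlet form of the depolarizing generator on the `k`-th qubit. -/
noncomputable def dirichletForm {n : ℕ} (k : Fin n) (Y : QubitMatrix n) : ℝ :=
  hsNormSq Y - (hsInner Y (partialExpectation k Y)).re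

/-- The matrix unit `|a⟩⟨b|` on the `k`-th qubit. -/
def qubitMatrixUnit {n : ℕ} (k : Fin n) (a b : Fin 2) : QubitMatrix n :=
  Matrix.of fun x u => if x k = a ∧ u = Function.update x k b then 1 else 0

/-- A Kraus form: it writes the expectation as a positive combination of maps `Y ↦ S Y Sᴴ`, to which
`re_hsInner_conj_le` applies term by term. -/
theorem partialExpectation_eq_sum {n : ℕ} (k : Fin n) (Y : QubitMatrix n) :
    partialExpectation k Y = ∑ a, ∑ b,
      (2⁻¹ : ℂ) • (qubitMatrixUnit k a b * Y * (qubitMatrixUnit k a b)ᴴ) := by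
  have h : ∀ a b x y, (qubitMatrixUnit k a b * Y * (qubitMatrixUnit k a b)ᴴ) x y
      = if x k = a ∧ y k = a then Y (Function.update x k b) (Function.update y k b) else 0 := by
    intro a b x y
    have h1 : ∀ v, (qubitMatrixUnit k a b * Y) x v
        = if x k = a then Y (Function.update x k b) v else 0 := by
      intro v
      rw [Matrix.mul_apply]
      by_cases hx : x k = a <;> simp [qubitMatrixUnit, hx]
    rw [Matrix.mul_apply]
    simp only [h1, Matrix.conjTranspose_apply]
    by_cases hx : x k = a <;> by_cases hy : y k = a <;> simp [qubitMatrixUnit, hx, hy]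
  ext x y
  simp only [Matrix.sum_apply, Matrix.smul_apply, h, partialExpectation, Matrix.of_apply,
    smul_eq_mul]
  by_cases hxy : x k = y k
  · rw [if_pos hxy, Finset.sum_comm, Finset.sum_div]
    refine Finset.sum_congr rfl fun b _ => ?_
    rw [Finset.sum_eq_single (x k)]
    · rw [if_pos ⟨rfl, hxy.symm⟩]; ring
    · intro a _ ha; rw [if_neg fun h => ha h.1.symm, mul_zero]
    · simp
  · rw [if_neg hxy]
    symm
    refine Finset.sum_eq_zero fun a _ => Finset.sum_eq_zero fun b _ => ?_
    rw [if_neg fun h => hxy (h.1.trans h.2.symm), mul_zero]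

/-- All three matrices have the same norm, so only their overlaps with the conditional expectation
have to be compared. -/
theorem dirichletForm_moduli_le {n : ℕ} (k : Fin n) {U V : QubitMatrix n}
    {y : (Fin n → Fin 2) → ℝ} (hU : Uᴴ * U = 1) (hV : Vᴴ * V = 1) (hy : ∀ i, 0 ≤ y i) :
    dirichletForm k (V * realDiagonal y * Vᴴ) + dirichletForm k (U * realDiagonal y * Uᴴ)
      ≤ 2 * dirichletForm k (U * realDiagonal y * Vᴴ) := by
  have hUH : Uᴴ * Uᴴᴴ = 1 := by rw [Matrix.conjTranspose_conjTranspose, hU]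
  have hVH : Vᴴ * Vᴴᴴ = 1 := by rw [Matrix.conjTranspose_conjTranspose, hV]
  have hE : ∀ Y : QubitMatrix n, (hsInner Y (partialExpectation k Y)).re = ∑ a, ∑ b,
      2⁻¹ * (hsInner Y (qubitMatrixUnit k a b * Y * (qubitMatrixUnit k a b)ᴴ)).re := by
    intro Y
    rw [partialExpectation_eq_sum]
    simp only [hsInner, Finset.mul_sum, Matrix.trace_sum, Matrix.mul_smul, Matrix.trace_smul,
      Complex.re_sum, smul_eq_mul]
    refine Finset.sum_congr rfl fun a _ => Finset.sum_congr rfl fun b _ => ?_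
    rw [show (2⁻¹ : ℂ) = ((2⁻¹ : ℝ) : ℂ) by push_cast; rfl, Complex.re_ofReal_mul]
  have key : 2 * (hsInner (U * realDiagonal y * Vᴴ)
      (partialExpectation k (U * realDiagonal y * Vᴴ))).re
      ≤ (hsInner (V * realDiagonal y * Vᴴ) (partialExpectation k (V * realDiagonal y * Vᴴ))).re
      + (hsInner (U * realDiagonal y * Uᴴ)
        (partialExpectation k (U * realDiagonal y * Uᴴ))).re := by
    rw [hE, hE, hE, Finset.mul_sum, ← Finset.sum_add_distrib]
    refine Finset.sum_le_sum fun a _ => ?_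
    rw [Finset.mul_sum, ← Finset.sum_add_distrib]
    refine Finset.sum_le_sum fun b _ => ?_
    have := re_hsInner_conj_le (U := U) (V := V) hy (qubitMatrixUnit k a b)
    linarith
  simp only [dirichletForm, hsNormSq_unitary_mul hU hUH, hsNormSq_unitary_mul hU hVH,
    hsNormSq_unitary_mul hV hVH]
  linarith

/-! ### Splitting off the first qubit, and the induction. -/

/-- The block of `M` at position `(a, b)` with respect to the first qubit. -/
def tailBlock {n : ℕ} (a b : Fin 2) (M : QubitMatrix (n + 1)) : QubitMatrix n :=
  Matrix.of fun x y => M (Fin.cons a x) (Fin.cons b y)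

theorem sum_cons {n : ℕ} {R : Type*} [AddCommMonoid R] (g : (Fin (n + 1) → Fin 2) → R) :
    ∑ x, g x = ∑ a, ∑ x : Fin n → Fin 2, g (Fin.cons a x) := by
  rw [← (Fin.consEquiv fun _ : Fin (n + 1) => Fin 2).sum_comp, Fintype.sum_prod_type]
  rfl

theorem hsInner_eq_sum_tailBlock {n : ℕ} (M N : QubitMatrix (n + 1)) :
    hsInner M N = ∑ a, ∑ b, hsInner (tailBlock a b M) (tailBlock a b N) := by
  simp only [hsInner_eq_sum]
  rw [sum_cons]
  refine Finset.sum_congr rfl fun a _ => ?_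
  rw [Finset.sum_comm' (t' := Finset.univ) (s' := fun _ => Finset.univ) (by simp)]
  simp only [sum_cons (n := n) (R := ℂ) (g := fun y => ∑ x : Fin n → Fin 2,
    (starRingEnd ℂ) (M (Fin.cons a x) y) * N (Fin.cons a x) y)]
  refine Finset.sum_congr rfl fun b _ => ?_
  rw [Finset.sum_comm]
  rfl

theorem tailBlock_partialExpectation_succ {n : ℕ} (k : Fin n) (a b : Fin 2)
    (M : QubitMatrix (n + 1)) :
    tailBlock a b (partialExpectation k.succ M) = partialExpectation k (tailBlock a b M) := by
  ext x y
  simp only [tailBlock, partialExpectation, Matrix.of_apply, Fin.cons_succ, ← Fin.cons_update]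

theorem tailBlock_partialExpectation_zero {n : ℕ} (a b : Fin 2) (M : QubitMatrix (n + 1)) :
    tailBlock a b (partialExpectation 0 M)
      = if a = b then (2⁻¹ : ℂ) • (tailBlock 0 0 M + tailBlock 1 1 M) else 0 := by
  ext x y
  simp only [tailBlock, partialExpectation, Matrix.of_apply, Fin.cons_zero, Fin.update_cons_zero,
    Fin.sum_univ_two]
  by_cases hab : a = b
  · simp only [if_pos hab, Matrix.smul_apply, Matrix.add_apply, Matrix.of_apply, smul_eq_mul]
    ring
  · simp [if_neg hab]

theorem hsNormSq_eq_sum_tailBlock {n : ℕ} (M : QubitMatrix (n + 1)) :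
    hsNormSq M = ∑ a, ∑ b, hsNormSq (tailBlock a b M) := by
  simp only [← hsInner_self_re]
  rw [hsInner_eq_sum_tailBlock]
  simp only [Complex.re_sum]

theorem dirichletForm_succ {n : ℕ} (k : Fin n) (M : QubitMatrix (n + 1)) :
    dirichletForm k.succ M = ∑ a, ∑ b, dirichletForm k (tailBlock a b M) := by
  simp only [dirichletForm, Finset.sum_sub_distrib]
  rw [hsNormSq_eq_sum_tailBlock, hsInner_eq_sum_tailBlock]
  simp only [Complex.re_sum, tailBlock_partialExpectation_succ]

theorem dirichletForm_zero {n : ℕ} (M : QubitMatrix (n + 1)) :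
    dirichletForm 0 M = hsNormSq M - hsNormSq (tailBlock 0 0 M + tailBlock 1 1 M) / 2 := by
  rw [dirichletForm, hsInner_eq_sum_tailBlock]
  simp only [tailBlock_partialExpectation_zero, Fin.sum_univ_two]
  simp only [↓reduceIte, zero_ne_one, one_ne_zero]
  rw [← hsInner_self_re (_ + _)]
  simp only [hsInner, Matrix.mul_zero, Matrix.trace_zero, add_zero, zero_add, Matrix.mul_smul,
    Matrix.trace_smul, Matrix.conjTranspose_add, add_mul, Matrix.trace_add, smul_eq_mul]
  rw [← mul_add, show (2⁻¹ : ℂ) = ((2⁻¹ : ℝ) : ℂ) by push_cast; rfl, Complex.re_ofReal_mul]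
  ring

/-- Splitting off the first bit of a bit string. -/
noncomputable def sumConsEquiv (n : ℕ) :
    (Fin n → Fin 2) ⊕ (Fin n → Fin 2) ≃ (Fin (n + 1) → Fin 2) :=
  Equiv.ofBijective (Sum.elim (fun x => (Fin.cons 0 x : Fin (n + 1) → Fin 2))
    fun x => (Fin.cons 1 x : Fin (n + 1) → Fin 2)) <| by
    constructor
    · rintro (x | x) (y | y) h
      · exact congrArg Sum.inl (Fin.cons_right_injective (α := fun _ => Fin 2) 0 h)
      · have := congrFun h 0
        simp at this
      · have := congrFun h 0
        simp at this
      · exact congrArg Sum.inr (Fin.cons_right_injective (α := fun _ => Fin 2) 1 h)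
    · intro x
      rcases Fin.exists_fin_two.1 ⟨x 0, rfl⟩ with h | h
      · exact ⟨Sum.inl (Fin.tail x), by rw [Sum.elim_inl, ← h, Fin.cons_self_tail]⟩
      · exact ⟨Sum.inr (Fin.tail x), by rw [Sum.elim_inr, ← h, Fin.cons_self_tail]⟩

theorem submatrix_sumConsEquiv {n : ℕ} (M : QubitMatrix (n + 1)) :
    M.submatrix (sumConsEquiv n) (sumConsEquiv n) = Matrix.fromBlocks (tailBlock 0 0 M)
      (tailBlock 0 1 M) (tailBlock 1 0 M) (tailBlock 1 1 M) := by
  ext (x | x) (y | y) <;> rfl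

omit [DecidableEq ι] [DecidableEq κ] in
theorem hsNormSq_submatrix_equiv (e : κ ≃ ι) (M : Matrix ι ι ℂ) :
    hsNormSq (M.submatrix e e) = hsNormSq M := by
  simp only [hsNormSq, Matrix.submatrix_apply]
  rw [e.sum_comp fun i => ∑ j, Complex.normSq (M i (e j))]
  exact Finset.sum_congr rfl fun i _ => e.sum_comp fun j => Complex.normSq (M i j)

theorem relEntropy_submatrix_equiv (e : κ ≃ ι) (M : Matrix ι ι ℂ) :
    relEntropy (M.submatrix e e) = relEntropy M := by
  rw [relEntropy, relEntropy, hsNormSq_submatrix_equiv, hsEntropy, hsEntropy,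
    Matrix.conjTranspose_submatrix, Matrix.submatrix_mul_equiv, spectralSum_submatrix_equiv]

/-- The logarithmic Sobolev inequality for the depolarizing generators of `n` qubits. -/
theorem relEntropy_le_dirichletForm (n : ℕ) (Y : QubitMatrix n) :
    relEntropy Y + n * Real.log 2 * hsNormSq Y ≤ 2 * ∑ k, dirichletForm k Y := by
  induction n with
  | zero =>
    obtain ⟨U, V, y, hU, hU', hV, hV', -, hY⟩ := exists_singularValueDecomposition Y
    have hVH : Vᴴ * Vᴴᴴ = 1 := by rw [Matrix.conjTranspose_conjTranspose, hV]
    rw [hY, relEntropy_unitary_mul hU hVH, relEntropy, hsEntropy_realDiagonal,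
      hsNormSq_realDiagonal]
    simp
  | succ n ih =>
    -- For positive `M`, the first qubit is paid for by the block inequality, and the others by the
    -- induction hypothesis on the four blocks. The extra `Real.log 2` comes from the block
    -- inequality.
    have hpos : ∀ M : QubitMatrix (n + 1), M.PosSemidef →
        relEntropy M + ((n + 1 : ℕ) : ℝ) * Real.log 2 * hsNormSq M
          ≤ 2 * ∑ k, dirichletForm k M := by
      intro M hM
      have h10 : tailBlock 1 0 M = (tailBlock 0 1 M)ᴴ := by
        ext x y
        exact (hM.1.apply _ _).symm
      have hb := submatrix_sumConsEquiv M
      rw [h10] at hb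
      have hps := hM.submatrix (sumConsEquiv n)
      rw [hb] at hps
      have h := relEntropy_fromBlocks_le hps
      rw [← hb, relEntropy_submatrix_equiv, hsNormSq_submatrix_equiv] at h
      have h00 := ih (tailBlock 0 0 M)
      have h01 := ih (tailBlock 0 1 M)
      have h10' := ih (tailBlock 1 0 M)
      have h11 := ih (tailBlock 1 1 M)
      have hr : relEntropy (tailBlock 1 0 M) = relEntropy (tailBlock 0 1 M) := by
        rw [h10, relEntropy_conjTranspose]
      have hN := hsNormSq_eq_sum_tailBlock M
      simp only [Fin.sum_univ_two] at hN
      rw [Fin.sum_univ_succ, dirichletForm_zero]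
      simp only [dirichletForm_succ, Fin.sum_univ_two, Finset.sum_add_distrib]
      have hN' : (n : ℝ) * Real.log 2 * hsNormSq M = n * Real.log 2 * hsNormSq (tailBlock 0 0 M)
          + n * Real.log 2 * hsNormSq (tailBlock 0 1 M)
          + n * Real.log 2 * hsNormSq (tailBlock 1 0 M)
          + n * Real.log 2 * hsNormSq (tailBlock 1 1 M) := by rw [hN]; ring
      push_cast
      linarith
    obtain ⟨U, V, y, hU, hU', hV, hV', hy, hY⟩ := exists_singularValueDecomposition Y
    have hUH : Uᴴ * Uᴴᴴ = 1 := by rw [Matrix.conjTranspose_conjTranspose, hU]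
    have hVH : Vᴴ * Vᴴᴴ = 1 := by rw [Matrix.conjTranspose_conjTranspose, hV]
    have hd : (realDiagonal y).PosSemidef := by
      refine Matrix.PosSemidef.diagonal fun i => ?_
      exact Complex.zero_le_real.2 (hy i)
    -- The moduli `V y Vᴴ` and `U y Uᴴ` are positive and share the entropy and norm of `Y`.
    -- Averaging their two inequalities gives the one for `Y`.
    have hPV := hpos _ (hd.mul_mul_conjTranspose_same V)
    have hPU := hpos _ (hd.mul_mul_conjTranspose_same U)
    rw [relEntropy_unitary_mul hV hVH, hsNormSq_unitary_mul hV hVH] at hPV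
    rw [relEntropy_unitary_mul hU hUH, hsNormSq_unitary_mul hU hUH] at hPU
    rw [hY, relEntropy_unitary_mul hU hVH, hsNormSq_unitary_mul hU hVH]
    have hsum := Finset.sum_le_sum fun k (_ : k ∈ Finset.univ) =>
      dirichletForm_moduli_le k hU hV hy
    rw [Finset.sum_add_distrib, ← Finset.mul_sum] at hsum
    linarith

/-! ### From depolarizing to unit rate generators. -/

omit [DecidableEq ι] in
theorem hsInner_conj (A B : Matrix ι ι ℂ) : hsInner B A = (starRingEnd ℂ) (hsInner A B) := by
  rw [hsInner, hsInner, starRingEnd_apply, ← Matrix.trace_conjTranspose,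
    Matrix.conjTranspose_mul, Matrix.conjTranspose_conjTranspose]

omit [DecidableEq ι] in
theorem IsSelfAdjointMap.im_hsInner {L : Superoperator ι} (hL : IsSelfAdjointMap L)
    (M : Matrix ι ι ℂ) : (hsInner M (L M)).im = 0 := by
  have h := hL M M
  rw [hsInner_conj M (L M)] at h
  exact Complex.conj_eq_iff_im.1 h.symm

/-- The depolarizing generator `M ↦ M - τ(M) I`. -/
noncomputable def depolarizingGenerator : Superoperator (Fin 2) :=
  LinearMap.id - ((2⁻¹ : ℂ) • Matrix.traceLinearMap (Fin 2) ℂ ℂ).smulRight 1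

theorem depolarizingGenerator_apply (M : Matrix (Fin 2) (Fin 2) ℂ) :
    depolarizingGenerator M = M - (M.trace / 2) • (1 : Matrix (Fin 2) (Fin 2) ℂ) := by
  simp [depolarizingGenerator, div_eq_inv_mul]

theorem re_hsInner_depolarizingGenerator (M : Matrix (Fin 2) (Fin 2) ℂ) :
    (hsInner M (depolarizingGenerator M)).re
      = hsNormSq (M - (M.trace / 2) • (1 : Matrix (Fin 2) (Fin 2) ℂ)) := by
  rw [depolarizingGenerator_apply, ← hsInner_self_re]
  have h : hsInner ((M.trace / 2) • (1 : Matrix (Fin 2) (Fin 2) ℂ))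
      (M - (M.trace / 2) • (1 : Matrix (Fin 2) (Fin 2) ℂ)) = 0 := by
    simp [hsInner, Matrix.trace_sub, Matrix.conjTranspose_smul]
  have h2 : ∀ A B C : Matrix (Fin 2) (Fin 2) ℂ, hsInner (A - B) C = hsInner A C - hsInner B C := by
    intro A B C
    simp [hsInner, Matrix.conjTranspose_sub, sub_mul, Matrix.trace_sub]
  rw [h2 M, h, sub_zero]

/-- A unit rate generator dominates the depolarizing generator. -/
theorem re_hsInner_depolarizingGenerator_le {H : Superoperator (Fin 2)}
    (hH : H ∈ unitRateGenerators) (M : Matrix (Fin 2) (Fin 2) ℂ) :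
    (hsInner M (depolarizingGenerator M)).re ≤ (hsInner M (H M)).re := by
  obtain ⟨⟨⟨h1, hsa, hpos⟩, -⟩, hmin⟩ := hH
  rw [re_hsInner_depolarizingGenerator]
  set N := M - (M.trace / 2) • (1 : Matrix (Fin 2) (Fin 2) ℂ) with hN
  have htr : N.trace = 0 := by
    rw [hN, Matrix.trace_sub, Matrix.trace_smul, Matrix.trace_one]
    simp
  have hHN : H M = H N := by rw [hN, map_sub, map_smul, h1, smul_zero, sub_zero]
  -- Self-adjointness and `H 1 = 0` remove the identity component from both slots, so the spectral
  -- gap can be applied to the traceless part `N`.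
  have hMN : hsInner M (H M) = hsInner N (H N) := by
    rw [hHN, hsa M N, hHN, ← hsa N N]
  rw [hMN]
  by_cases hN0 : N = 0
  · rw [hN0]; simp [hsNormSq, hsInner]
  have hNpos : 0 < hsNormSq N := by
    refine (hsNormSq_nonneg N).lt_of_ne' fun h => hN0 ?_
    ext i j
    have h2 := (Finset.sum_eq_zero_iff_of_nonneg fun i _ =>
      Finset.sum_nonneg fun j _ => Complex.normSq_nonneg (N i j)).1 h i (Finset.mem_univ i)
    have h3 := (Finset.sum_eq_zero_iff_of_nonneg fun j _ =>
      Complex.normSq_nonneg (N i j)).1 h2 j (Finset.mem_univ j)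
    exact Complex.normSq_eq_zero.1 h3
  have hle : minNorm H ≤ (hsInner N (H N)).re / (hsInner N N).re := by
    refine csInf_le ⟨0, ?_⟩ ⟨N, hN0, htr, rfl⟩
    rintro r ⟨K, -, -, rfl⟩
    exact div_nonneg (hpos K) (by rw [hsInner_self_re]; exact hsNormSq_nonneg K)
  rw [hmin, hsInner_self_re, le_div_iff₀ hNpos, one_mul] at hle
  exact hle

theorem sum_sum_update {n : ℕ} (k : Fin n) (g : (Fin n → Fin 2) → ℂ) :
    ∑ x, ∑ c, g (Function.update x k c) = 2 * ∑ x, g x := by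
  have hinv : Function.Involutive fun x : Fin n → Fin 2 => Function.update x k (x k + 1) := by
    intro x
    have : ∀ c : Fin 2, c + 1 + 1 = c := by decide
    simp [this]
  have h : ∀ x : Fin n → Fin 2, ∑ c, g (Function.update x k c)
      = g x + g (Function.update x k (x k + 1)) := by
    intro x
    have e : g x = g (Function.update x k (x k)) := by rw [Function.update_eq_self]
    rw [e, Fin.sum_univ_two]
    rcases Fin.exists_fin_two.1 ⟨x k, rfl⟩ with h | h
    · rw [h]; rfl
    · rw [h, add_comm]; rfl
  simp only [h, Finset.sum_add_distrib]
  rw [show ∑ x, g (Function.update x k (x k + 1)) = ∑ x, g x from Equiv.sum_comp hinv.toPerm g,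
    two_mul]

/-- The `2 × 2` block of `A` through `(x, y)` in which only the `k`-th indices vary. -/
def qubitBlock {n : ℕ} (k : Fin n) (A : QubitMatrix n) (x y : Fin n → Fin 2) :
    Matrix (Fin 2) (Fin 2) ℂ :=
  Matrix.of fun a b => A (Function.update x k a) (Function.update y k b)

/-- The block through `(x, y)` does not depend on `x k` and `y k`, so each block occurs four times
in the double sum. Quadratic form bounds on `2 × 2` matrices thus lift to `n` qubits. -/
theorem hsInner_onQubit {n : ℕ} (k : Fin n) (L : Superoperator (Fin 2)) (A : QubitMatrix n) :
    4 * hsInner A (onQubit k L A)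
      = ∑ x, ∑ y, hsInner (qubitBlock k A x y) (L (qubitBlock k A x y)) := by
  have hb : ∀ x y a b, qubitBlock k A (Function.update x k a) (Function.update y k b)
      = qubitBlock k A x y := by
    intro x y a b
    ext c d
    simp [qubitBlock]
  set g : (Fin n → Fin 2) → (Fin n → Fin 2) → ℂ :=
    fun x y => (starRingEnd ℂ) (A x y) * L (qubitBlock k A x y) (x k) (y k) with hg
  have h1 : hsInner A (onQubit k L A) = ∑ x, ∑ y, g x y := hsInner_eq_sum _ _
  have h2 : ∀ x y, hsInner (qubitBlock k A x y) (L (qubitBlock k A x y))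
      = ∑ a, ∑ b, g (Function.update x k a) (Function.update y k b) := by
    intro x y
    rw [hsInner_eq_sum]
    refine Finset.sum_congr rfl fun a _ => Finset.sum_congr rfl fun b _ => ?_
    simp only [hg, hb, Function.update_self]
    rfl
  have h3 : ∀ a, ∑ x, ∑ y, ∑ b, g (Function.update x k a) (Function.update y k b)
      = 2 * ∑ x, ∑ y, g (Function.update x k a) y := by
    intro a
    rw [Finset.mul_sum]
    exact Finset.sum_congr rfl fun x _ => sum_sum_update k _
  calc 4 * hsInner A (onQubit k L A) = 2 * (2 * ∑ x, ∑ y, g x y) := by rw [h1]; ring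
    _ = 2 * ∑ x, ∑ a, ∑ y, g (Function.update x k a) y := by
      rw [sum_sum_update k fun x => ∑ y, g x y]
    _ = ∑ a, ∑ x, ∑ y, ∑ b, g (Function.update x k a) (Function.update y k b) := by
      rw [Finset.sum_comm, Finset.mul_sum]
      exact Finset.sum_congr rfl fun a _ => (h3 a).symm
    _ = ∑ x, ∑ y, hsInner (qubitBlock k A x y) (L (qubitBlock k A x y)) := by
      rw [Finset.sum_comm]
      refine Finset.sum_congr rfl fun x _ => ?_
      rw [Finset.sum_comm]
      exact Finset.sum_congr rfl fun y _ => (h2 x y).symm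

theorem onQubit_depolarizingGenerator {n : ℕ} (k : Fin n) (A : QubitMatrix n) :
    onQubit k depolarizingGenerator A = A - partialExpectation k A := by
  ext x y
  change depolarizingGenerator (qubitBlock k A x y) (x k) (y k) = _
  rw [depolarizingGenerator_apply, Matrix.sub_apply, Matrix.sub_apply, Matrix.smul_apply,
    Matrix.one_apply]
  simp only [qubitBlock, Matrix.of_apply, Function.update_eq_self, partialExpectation,
    Matrix.trace, Matrix.diag_apply, smul_eq_mul, mul_ite, mul_one, mul_zero]

theorem dirichletForm_le {n : ℕ} (k : Fin n) {H : Superoperator (Fin 2)}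
    (hH : H ∈ unitRateGenerators) (A : QubitMatrix n) :
    dirichletForm k A ≤ (hsInner A (onQubit k H A)).re := by
  have h1 : dirichletForm k A = (hsInner A (onQubit k depolarizingGenerator A)).re := by
    rw [onQubit_depolarizingGenerator, dirichletForm, ← hsInner_self_re]
    simp [hsInner, mul_sub, Matrix.trace_sub]
  have hre : ∀ L : Superoperator (Fin 2), 4 * (hsInner A (onQubit k L A)).re
      = ∑ x, ∑ y, (hsInner (qubitBlock k A x y) (L (qubitBlock k A x y))).re := by
    intro L
    have := congrArg Complex.re (hsInner_onQubit k L A)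
    simpa only [Complex.re_sum, Complex.mul_re, Complex.re_ofNat, Complex.im_ofNat, zero_mul,
      sub_zero] using this
  have h2 : 4 * (hsInner A (onQubit k depolarizingGenerator A)).re
      ≤ 4 * (hsInner A (onQubit k H A)).re := by
    rw [hre, hre]
    exact Finset.sum_le_sum fun x _ => Finset.sum_le_sum fun y _ =>
      re_hsInner_depolarizingGenerator_le hH _
  linarith

theorem im_hsInner_onQubit {n : ℕ} (k : Fin n) {L : Superoperator (Fin 2)}
    (hL : IsSelfAdjointMap L) (A : QubitMatrix n) : (hsInner A (onQubit k L A)).im = 0 := by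
  have := congrArg Complex.im (hsInner_onQubit k L A)
  simp only [Complex.im_sum, hL.im_hsInner, Finset.sum_const_zero, Complex.mul_im,
    Complex.re_ofNat, Complex.im_ofNat, zero_mul, add_zero] at this
  linarith

theorem trace_mul_matLog {B : Matrix ι ι ℂ} (hB : B.IsHermitian) :
    (B * matLog B).trace = (spectralSum (fun t => t * Real.log t) B : ℂ) := by
  have hsa : IsSelfAdjoint B := hB
  have h1 : B * matLog B = cfc (fun t => t * Real.log t) B := by
    -- The spectrum is finite, so every function is continuous on it, including the logarithm when
    -- `0` is an eigenvalue.
    have hc : ∀ f : ℝ → ℝ, ContinuousOn f (spectrum ℝ B) := fun f =>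
      (Matrix.finite_real_spectrum (A := B)).continuousOn f
    rw [cfc_mul _ _ B (hc _) (hc _), cfc_id' ℝ B, matLog]
  rw [h1, Matrix.trace_eq_sum_roots_charpoly, hB.charpoly_cfc_eq, Polynomial.roots_prod]
  · rw [spectralSum_isHermitian _ hB]
    simp only [Polynomial.roots_X_sub_C]
    simp
  · exact Finset.prod_ne_zero_iff.2 fun i _ => Polynomial.X_sub_C_ne_zero _

end QubitLogSobolev

open QubitLogSobolev
/-- For unit rate generators `H₁, …, Hₙ` and `A ≥ 0` in `ℳ_{2^n}`:
`-τ(A²) ln τ(A²) + τ(A² ln A²) ≤ 2 ∑ₖ τ(A H^{(k)}(A))`, where all the traces are real numbers. -/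
theorem mainTheorem6 (n : ℕ) (H : Fin n → Superoperator (Fin 2))
    (hH : ∀ k, H k ∈ unitRateGenerators) (A : QubitMatrix n) (hA : A.PosSemidef) :
    (normTrace (A ^ 2)).im = 0 ∧
    (normTrace (A ^ 2 * matLog (A ^ 2))).im = 0 ∧
    (∀ k, (normTrace (A * onQubit k (H k) A)).im = 0) ∧
    -((normTrace (A ^ 2)).re * Real.log (normTrace (A ^ 2)).re)
        + (normTrace (A ^ 2 * matLog (A ^ 2))).re
      ≤ 2 * ∑ k, (normTrace (A * onQubit k (H k) A)).re := by
  have hAH : Aᴴ = A := hA.1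
  have hcard : (Fintype.card (Fin n → Fin 2) : ℂ) = ((2 ^ n : ℝ) : ℂ) := by simp
  have hsq : A ^ 2 = Aᴴ * A := by rw [hAH, pow_two]
  have hherm : (A ^ 2).IsHermitian := by
    rw [hsq]; exact (Matrix.posSemidef_conjTranspose_mul_self A).1
  have t1 : normTrace (A ^ 2) = ((hsNormSq A / 2 ^ n : ℝ) : ℂ) := by
    have him : (Aᴴ * A).trace.im = 0 := by
      have := hsInner_conj A A
      exact Complex.conj_eq_iff_im.1 this.symm
    rw [normTrace, hcard, hsq, hsNormSq_eq_trace, Complex.ofReal_div]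
    congr 1
    exact Complex.ext rfl him
  have t2 : normTrace (A ^ 2 * matLog (A ^ 2)) = ((hsEntropy A / 2 ^ n : ℝ) : ℂ) := by
    rw [normTrace, hcard, trace_mul_matLog hherm, hsq, hsEntropy, Complex.ofReal_div]
  have t3 : ∀ k, normTrace (A * onQubit k (H k) A)
      = (((hsInner A (onQubit k (H k) A)).re / 2 ^ n : ℝ) : ℂ) := by
    intro k
    have him := im_hsInner_onQubit k (hH k).1.1.2.1 A
    rw [normTrace, hcard, Complex.ofReal_div]
    congr 1
    rw [show (A * onQubit k (H k) A).trace = hsInner A (onQubit k (H k) A) by rw [hsInner, hAH]]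
    exact Complex.ext rfl him
  refine ⟨by rw [t1, Complex.ofReal_im], by rw [t2, Complex.ofReal_im],
    fun k => by rw [t3, Complex.ofReal_im], ?_⟩
  simp only [t1, t2, t3, Complex.ofReal_re]
  have h2n : (0 : ℝ) < 2 ^ n := by positivity
  -- Passing from `Tr` to `τ` divides the norm by `2 ^ n`; this is the source of the term `n *
  -- Real.log 2 * hsNormSq A` in `relEntropy_le_dirichletForm`.
  have hlog : hsNormSq A / 2 ^ n * Real.log (hsNormSq A / 2 ^ n)
      = (hsNormSq A * Real.log (hsNormSq A) - n * Real.log 2 * hsNormSq A) / 2 ^ n := by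
    by_cases h0 : hsNormSq A = 0
    · rw [h0]; simp
    · rw [Real.log_div h0 h2n.ne', Real.log_pow]; ring
  have hmain := relEntropy_le_dirichletForm n A
  have hsum : ∑ k, dirichletForm k A ≤ ∑ k, (hsInner A (onQubit k (H k) A)).re :=
    Finset.sum_le_sum fun k _ => dirichletForm_le k (hH k) A
  rw [relEntropy] at hmain
  rw [hlog, ← Finset.sum_div, ← mul_div_assoc, ← neg_div, ← add_div,
    div_le_div_iff_of_pos_right h2n]
  linarith
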